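/- **Setting.** Let $\mathbb T=\mathbb R/\mathbb Z$, $\mathfrak H=L^2(\mathbb T;\mathbb C)$ and $h=\frac12(-\Delta+1)$ on $\mathfrak H$, with eigenvalues $\lambda_k=\frac12((2\pi k)^2+1)$ and eigenfunctions $u_k(x)=e^{2\pi i kx}$, $k\in\mathbb Z$. Let $\mu_0$ be the law on $\mathfrak H$ of the random series $\sum_{k} g_k\lambda_k^{-1/2}u_k$, where the $g_k$ are independent standard complex Gaussian variables (density $\pi^{-1}e^{-|z|^2}$). Let $\mathfrak F(\mathfrak H)$ be the bosonic Fock space over $\mathfrak H$, $\mathcal N$ the number operator and, for $\tau>0$, $$\Gamma_{\tau,0}=\frac{e^{-\mathrm d\Gamma(h)/\tau}}{\mathrm{Tr}\,e^{-\mathrm d\Gamma(h)/\tau}}$$ the free Gibbs state. For $\Lambda>0$ let $P=\mathbb 1(h\le\Lambda)$, let $\mathcal N_P$ be the number operator on $\mathfrak F(P\mathfrak H)$ and $\Gamma_{\tau,0,P}=e^{-\mathrm d\Gamma(PhP)/\tau}/\mathrm{Tr}\,e^{-\mathrm d\Gamma(PhP)/\tau}$ the free Gibbs state on $\mathfrak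 F(P\mathfrak H)$. Let $K>0$ and let $(f_\eta)_{0<\eta<K^2/2}$ be a family of non-trivial functions $f_\eta\in C_c^\infty([0,\infty);[0,1])$ such that $f_\eta(s)=1$ for $s\le K^2-\eta$, $f_\eta(s)=0$ for $s>K^2$, $\sup_{0<\eta<K^2/2}\eta^{j}\|f_\eta^{(j)}\|_{L^\infty}<\infty$ for every $j\ge1$, and $f_\eta\to\mathbb 1_{[0,K^2)}$ pointwise as $\eta\to0$. **Proposition.** All the operators $e^{-\mathrm d\Gamma(h)/\tau}$, $e^{-\mathrm d\Gamma(PhP)/\tau}$ and all the operators whose traces appear below are trace class, and the following hold. 1. As $\tau\to\infty$ and $\eta\to0$ with $\tau^{-1/64}\le\eta<\frac12K^2$, $$\Big|\mathrm{Tr}_{\mathfrak F(\mathfrak H)}\big(\Gamma_{\tau,0}\,f_\eta(\mathcal N/\tau)\big)-\int_{\mathfrak H}f_\eta(\|u\|_{L^2}^2)\,\mathrm d\mu_0(u)\Big|\to0 .$$ 2. For every $g\in C_c^\infty([0,\infty);[0,\infty))$, $$\lim_{\tau\to\infty}\mathrm{Tr}_{\mathfrak F(\mathfrak H)}\big(\Gamma_{\tau,0}\,g(\mathcal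 N/\tau)\big)=\int_{\mathfrak H}g(\|u\|_{L^2}^2)\,\mathrm d\mu_0(u).$$ 3. There are $C>0$ and $\tau_0>0$, depending only on $K$ and the family $(f_\eta)$, such that for all $\tau\ge\tau_0$, $\eta\in(0,\frac12K^2)$ and $\Lambda>0$ with $\eta^{-1}\le\Lambda^{1/8}\le\tau^{1/32}$, $$\Big|\mathrm{Tr}_{\mathfrak F(P\mathfrak H)}\big(\Gamma_{\tau,0,P}\,f_\eta(\mathcal N_P/\tau)\big)-\int_{\mathfrak H}f_\eta(\|Pu\|_{L^2}^2)\,\mathrm d\mu_0(u)\Big|\le C\,\tau^{-1/4}.$$ -/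

import Mathlib

open MeasureTheory Filter Topology
open scoped ENNReal ContDiff InnerProductSpace

noncomputable section

namespace FreeGibbs

/-! ### Unbounded operators, functional calculus, trace -/

/-- A (possibly unbounded) linear operator on `E`, given by its graph: `(ψ, φ) ∈ A` means that
`ψ` lies in the domain of `A` and `A ψ = φ`. -/
abbrev Operator (E : Type*) [AddCommGroup E] [Module ℂ E] := Submodule ℂ (E × E)

section Abstract

variable {E : Type*} [NormedAddCommGroup E] [InnerProductSpace ℂ E]

/-- The operator `c A`, on the domain of `A`. -/
def scale (c : ℂ) (A : Operator E) : Operator E :=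
  A.map (LinearMap.prodMap LinearMap.id (c • LinearMap.id))

/-- The compression `P A P` of `A`, seen as an operator on the range of the projection `P`:
its domain is the set of `u` in the range of `P` that lie in the domain of `A`, and it maps `u`
to `P A u`. -/
def compress (P : E →L[ℂ] E) (A : Operator E) : Operator E :=
  (A ⊓ (LinearMap.range (P : E →ₗ[ℂ] E)).prod ⊤).map
    (LinearMap.prodMap LinearMap.id (P : E →ₗ[ℂ] E))

/-- The eigenspace `{ψ : A ψ = e ψ}` of `A`. -/
def eigenspace (A : Operator E) (e : ℝ) : Submodule ℂ E :=
  A.comap (LinearMap.prod LinearMap.id ((e : ℂ) • LinearMap.id))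

variable [CompleteSpace E]

/-- The orthogonal projection onto the eigenspace of `A` for the eigenvalue `e` (the closure plays
no role for a closed operator, whose eigenspaces are closed). -/
def eigenproj (A : Operator E) (e : ℝ) : E →L[ℂ] E :=
  (eigenspace A e).topologicalClosure.starProjection

/-- `T = F(A)` for an operator `A` with pure point spectrum: the eigenprojections of `A` sum
strongly to the identity, and `T = ∑ₑ F(e) 1_{A = e}` strongly. -/
def IsFunctionOf (A : Operator E) (F : ℝ → ℝ) (T : E →L[ℂ] E) : Prop :=
  ∀ ψ : E, HasSum (fun e : ℝ => eigenproj A e ψ) ψ ∧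
    HasSum (fun e : ℝ => (F e : ℂ) • eigenproj A e ψ) (T ψ)

open Classical in
/-- The bounded operator `F(A)` of the functional calculus, for `A` with pure point spectrum and
`F` bounded on it (and `0` if there is no such bounded operator). -/
def functionOf (A : Operator E) (F : ℝ → ℝ) : E →L[ℂ] E :=
  if h : ∃ T, IsFunctionOf A F T then h.choose else 0

/-- The functional calculus takes the only possible value. -/
theorem functionOf_eq {A : Operator E} {F : ℝ → ℝ} {T : E →L[ℂ] E} (h : IsFunctionOf A F T) :
    functionOf A F = T := by
  have h' : ∃ T, IsFunctionOf A F T := ⟨T, h⟩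
  rw [functionOf, dif_pos h']
  ext ψ
  exact (h'.choose_spec ψ).2.unique (h ψ).2

/-- `T` is trace class: `∑ᵢ ⟨bᵢ, |T| bᵢ⟩ < ∞` for an orthonormal basis `b`, where
`|T| = √(T* T)`. -/
def IsTraceClass (T : E →L[ℂ] E) : Prop :=
  ∃ (w : Set E) (b : HilbertBasis w ℂ E),
    Summable fun i => ⟪b i, CFC.abs T (b i)⟫_ℂ

/-- The trace `∑ᵢ ⟨bᵢ, T bᵢ⟩` of a trace-class operator, in an orthonormal basis `b` of `E`
(the sum does not depend on its choice). -/
def trace (T : E →L[ℂ] E) : ℂ :=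
  ∑' i, ⟪(exists_hilbertBasis ℂ E).choose_spec.choose i,
    T ((exists_hilbertBasis ℂ E).choose_spec.choose i)⟫_ℂ

end Abstract

/-! ### The one-particle space and the one-body operator -/

/-- The torus `𝕋 = ℝ / ℤ`. -/
abbrev T : Type := UnitAddCircle

/-- Lebesgue measure on `𝕋`, of total mass one. -/
abbrev volT : Measure T := AddCircle.haarAddCircle

/-- The one-particle space `𝔥 = L²(𝕋; ℂ)`. -/
abbrev OneParticle : Type := Lp ℂ 2 volT

instance : MeasurableSpace OneParticle := borel _

instance : BorelSpace OneParticle := ⟨rfl⟩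

theorem measurePreserving_coe :
    MeasurePreserving (fun x : ℝ => (x : T)) (volume.restrict (Set.Ioc 0 1)) volT := by
  have h0 : (volume : Measure T) = volT := by
    simpa using AddCircle.volume_eq_smul_haarAddCircle (T := 1)
  have h1 := UnitAddCircle.measurePreserving_mk 0
  rw [zero_add, h0] at h1
  exact h1

theorem ae_comp_coe {u v : T → ℂ} (h : u =ᵐ[volT] v) :
    ∀ᵐ x : ℝ ∂(volume.restrict (Set.uIoc (0 : ℝ) 1)), u (x : T) = v (x : T) := by
  rw [Set.uIoc_of_le zero_le_one]
  exact measurePreserving_coe.quasiMeasurePreserving.ae h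

theorem intervalIntegrable_mul (u : OneParticle) {φ : ℝ → ℂ} (hφ : Continuous φ) :
    IntervalIntegrable (fun x : ℝ => u (x : T) * φ x) volume 0 1 := by
  have hu : Integrable (u : T → ℂ) volT := (Lp.memLp u).integrable (by norm_num)
  have h1 := measurePreserving_coe.integrable_comp_of_integrable hu
  have h2 : IntervalIntegrable (fun x : ℝ => u (x : T)) volume 0 1 := by
    rw [intervalIntegrable_iff_integrableOn_Ioc_of_le zero_le_one]
    exact h1
  exact h2.mul_continuousOn hφ.continuousOn

theorem continuous_testOperator {φ : ℝ → ℂ} (hφ : ContDiff ℝ ∞ φ) :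
    Continuous fun x => (1 / 2 : ℂ) * (-iteratedDeriv 2 φ x + φ x) := by
  have h2 : Continuous (iteratedDeriv 2 φ) := hφ.continuous_iteratedDeriv 2 (by norm_cast)
  have h0 := hφ.continuous
  fun_prop

theorem integral_add_mul (u v : OneParticle) {φ : ℝ → ℂ} (hφ : Continuous φ) :
    ∫ x in (0 : ℝ)..1, (u + v : OneParticle) (x : T) * φ x =
      (∫ x in (0 : ℝ)..1, u (x : T) * φ x) + ∫ x in (0 : ℝ)..1, v (x : T) * φ x := by
  rw [← intervalIntegral.integral_add (intervalIntegrable_mul u hφ) (intervalIntegrable_mul v hφ)]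
  refine intervalIntegral.integral_congr_ae_restrict ?_
  filter_upwards [ae_comp_coe (Lp.coeFn_add u v)] with x hx
  rw [hx, Pi.add_apply, add_mul]

theorem integral_smul_mul (c : ℂ) (u : OneParticle) (φ : ℝ → ℂ) :
    ∫ x in (0 : ℝ)..1, (c • u : OneParticle) (x : T) * φ x =
      c * ∫ x in (0 : ℝ)..1, u (x : T) * φ x := by
  rw [← intervalIntegral.integral_const_mul]
  refine intervalIntegral.integral_congr_ae_restrict ?_
  filter_upwards [ae_comp_coe (Lp.coeFn_smul c u)] with x hx
  rw [hx, Pi.smul_apply, smul_eq_mul, mul_assoc]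

/-- The one-body operator `h = (-Δ + 1) / 2` on `L²(𝕋)`, in the sense of distributions: `u` is in
its domain and `h u = v` iff `u, v ∈ L²(𝕋)` and `∫ u (-φ'' + φ) / 2 = ∫ v φ` for all smooth
`1`-periodic `φ`. -/
def oneBody : Operator OneParticle where
  carrier := {p | ∀ φ : ℝ → ℂ, ContDiff ℝ ∞ φ → Function.Periodic φ 1 →
    ∫ x in (0 : ℝ)..1, p.1 (x : T) * ((1 / 2 : ℂ) * (-iteratedDeriv 2 φ x + φ x)) =
      ∫ x in (0 : ℝ)..1, p.2 (x : T) * φ x}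
  add_mem' := by
    intro p q hp hq φ h1 h2
    simp only [Prod.fst_add, Prod.snd_add]
    rw [integral_add_mul _ _ (continuous_testOperator h1), integral_add_mul _ _ h1.continuous,
      hp φ h1 h2, hq φ h1 h2]
  zero_mem' := by
    intro φ _ _
    have e1 := integral_smul_mul 0 0 fun x => (1 / 2 : ℂ) * (-iteratedDeriv 2 φ x + φ x)
    have e2 := integral_smul_mul 0 0 φ
    rw [zero_smul, zero_mul] at e1 e2
    exact e1.trans e2.symm
  smul_mem' := by
    intro c p hp φ h1 h2
    simp only [Prod.smul_fst, Prod.smul_snd]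
    rw [integral_smul_mul, integral_smul_mul, hp φ h1 h2]

/-- The eigenvalues `λ_k = ((2πk)² + 1) / 2` of `h`; the eigenfunction for `λ_k` is
`e^{2πikx}`. -/
def eigenvalue (k : ℤ) : ℝ := ((2 * Real.pi * k) ^ 2 + 1) / 2

/-- The spectral projection `P = 1(h ≤ Λ)`. -/
def lowProj (Λ : ℝ) : OneParticle →L[ℂ] OneParticle :=
  functionOf oneBody (Set.indicator (Set.Iic Λ) 1)

/-! ### The free Gibbs measure -/

/-- The standard complex Gaussian measure `π⁻¹ e^{-|z|²} dz`. -/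
def stdGaussian : Measure ℂ :=
  volume.withDensity fun z => ENNReal.ofReal (1 / Real.pi * Real.exp (-‖z‖ ^ 2))

instance : IsProbabilityMeasure stdGaussian := by
  have h1 : ∫ z : ℂ, Real.exp (-1 * ‖z‖ ^ 2) = Real.pi := by
    rw [GaussianFourier.integral_rexp_neg_mul_sq_norm one_pos, Complex.finrank_real_complex]
    norm_num
  have h2 : Integrable fun z : ℂ => Real.exp (-1 * ‖z‖ ^ 2) := by
    refine Integrable.of_integral_ne_zero ?_
    rw [h1]
    exact Real.pi_ne_zero
  have h3 : ∫ z : ℂ, 1 / Real.pi * Real.exp (-‖z‖ ^ 2) = 1 := by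
    rw [integral_const_mul]
    simp only [neg_one_mul] at h1
    rw [h1, one_div, inv_mul_cancel₀ Real.pi_ne_zero]
  refine ⟨?_⟩
  rw [stdGaussian, withDensity_apply _ MeasurableSet.univ, Measure.restrict_univ,
    ← ofReal_integral_eq_lintegral_ofReal, h3, ENNReal.ofReal_one]
  · simp only [neg_one_mul] at h2
    exact h2.const_mul _
  · exact Eventually.of_forall fun z => by positivity

/-- The classical free field `φ = ∑_k g_k λ_k^{-1/2} u_k` in `L²(𝕋)`, as a function of the
coordinates `g_k`. -/
def freeField (g : ℤ → ℂ) : OneParticle :=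
  ∑' k : ℤ, (g k / (Real.sqrt (eigenvalue k) : ℂ)) • (fourierLp 2 k : OneParticle)

/-- The free Gibbs measure `μ₀`: the law of the free field when the `g_k` are independent standard
complex Gaussian random variables. -/
def freeMeasure : Measure OneParticle :=
  (Measure.infinitePi fun _ : ℤ => stdGaussian).map freeField

/-! ### Fock spaces -/

/-- The Hilbert space `L²(𝕋ⁿ) = 𝔥^{⊗ n}`. -/
abbrev NParticle (n : ℕ) : Type := Lp ℂ 2 (Measure.pi fun _ : Fin n => volT)

theorem measurePreserving_perm {n : ℕ} (σ : Equiv.Perm (Fin n)) :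
    MeasurePreserving (fun x : Fin n → T => x ∘ σ) (Measure.pi fun _ : Fin n => volT)
      (Measure.pi fun _ : Fin n => volT) := by
  have := measurePreserving_piCongrLeft (fun _ : Fin n => volT) σ.symm
  convert this using 1
  ext x i
  simp [MeasurableEquiv.piCongrLeft, Equiv.piCongrLeft, Equiv.piCongrLeft']

/-- `Ψ` is the product function `(f₁ ⊗ ⋯ ⊗ fₙ)(x) = f₁(x₁) ⋯ fₙ(xₙ)`. -/
def IsTensor {n : ℕ} (f : Fin n → OneParticle) (Ψ : NParticle n) : Prop :=
  Ψ =ᵐ[Measure.pi fun _ : Fin n => volT] fun x => ∏ i, f i (x i)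

/-- For a subspace `V` of `𝔥`, the tensor power `V^{⊗ n}` in `L²(𝕋ⁿ)`: the closed linear span of
the products `f₁ ⊗ ⋯ ⊗ fₙ` with all `fᵢ` in `V`. -/
def tensorPower (V : Submodule ℂ OneParticle) (n : ℕ) : Submodule ℂ (NParticle n) :=
  (Submodule.span ℂ {Ψ | ∃ f : Fin n → OneParticle, (∀ i, f i ∈ V) ∧ IsTensor f Ψ}).topologicalClosure

/-- The functions in `L²(𝕋ⁿ)` that are symmetric under permutations of the variables. -/
def symmetricFunctions (n : ℕ) : Submodule ℂ (NParticle n) :=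
  ⨅ σ : Equiv.Perm (Fin n),
    LinearMap.eqLocus (Lp.compMeasurePreservingₗ ℂ (fun x => x ∘ σ) (measurePreserving_perm σ))
      (LinearMap.id)

/-- The bosonic `n`-particle space over `V`: the symmetric elements of `V^{⊗ n}`. -/
def sector (V : Submodule ℂ OneParticle) (n : ℕ) : Submodule ℂ (NParticle n) :=
  tensorPower V n ⊓ symmetricFunctions n

instance (V : Submodule ℂ OneParticle) (n : ℕ) : CompleteSpace (sector V n) := by
  refine IsClosed.completeSpace_coe (hs := ?_)
  have h1 : IsClosed (tensorPower V n : Set (NParticle n)) :=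
    Submodule.isClosed_topologicalClosure _
  have h2 : IsClosed (symmetricFunctions n : Set (NParticle n)) := by
    rw [symmetricFunctions, Submodule.coe_iInf]
    refine isClosed_iInter fun σ => ?_
    exact isClosed_eq
      (Lp.compMeasurePreservingₗᵢ ℂ (fun x => x ∘ σ) (measurePreserving_perm σ)).continuous
      continuous_id
  exact h1.inter h2

/-- The bosonic Fock space over `V`, the Hilbert sum of the bosonic `n`-particle spaces. -/
abbrev Fock (V : Submodule ℂ OneParticle) : Type := lp (fun n : ℕ => sector V n) 2

/-- The `n`-particle operator `A₁ + ⋯ + Aₙ` on `L²(𝕋ⁿ)`, `Aⱼ` being `A` acting on the `j`-th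
variable: the closure of the linear map defined on products of elements of the domain of `A` by
`f₁ ⊗ ⋯ ⊗ fₙ ↦ ∑ⱼ f₁ ⊗ ⋯ ⊗ A fⱼ ⊗ ⋯ ⊗ fₙ`. -/
def sumOperator (A : Operator OneParticle) (n : ℕ) : Operator (NParticle n) :=
  (Submodule.span ℂ {p : NParticle n × NParticle n | ∃ f g : Fin n → OneParticle,
    (∀ i, (f i, g i) ∈ A) ∧ IsTensor f p.1 ∧
      ∃ Ψ : Fin n → NParticle n, (∀ j, IsTensor (Function.update f j (g j)) (Ψ j)) ∧
        p.2 = ∑ j, Ψ j}).topologicalClosure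

/-- The second quantization `dΓ(A) = 0 ⊕ ⨁ₙ (A₁ + ⋯ + Aₙ)` on the Fock space over `V`, with its
maximal domain. -/
def secondQuantization (V : Submodule ℂ OneParticle) (A : Operator OneParticle) :
    Operator (Fock V) where
  carrier := {p | ∀ n, ((p.1 n : NParticle n), (p.2 n : NParticle n)) ∈ sumOperator A n}
  add_mem' := fun {_ _} ha hb n => (sumOperator A n).add_mem (ha n) (hb n)
  zero_mem' := fun n => (sumOperator A n).zero_mem
  smul_mem' := fun c _ ha n => (sumOperator A n).smul_mem c (ha n)

/-- The number operator `𝒩 = ⨁ₙ n 1` on the Fock space over `V`, with its maximal domain. -/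
def number (V : Submodule ℂ OneParticle) : Operator (Fock V) where
  carrier := {p | ∀ n, p.2 n = (n : ℂ) • p.1 n}
  add_mem' := by
    intro p q hp hq n
    have h1 := hp n
    have h2 := hq n
    simp only [Prod.fst_add, Prod.snd_add, lp.coeFn_add, Pi.add_apply, smul_add, h1, h2]
  zero_mem' := by
    intro n
    simp
  smul_mem' := by
    intro c p hp n
    have h1 := hp n
    simp only [Prod.smul_fst, Prod.smul_snd, lp.coeFn_smul, Pi.smul_apply, h1]
    exact smul_comm _ _ _

/-! ### Free Gibbs states -/

/-- `e^{-dΓ(A)/τ}` on the Fock space over `V`. -/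
def gibbsWeight (V : Submodule ℂ OneParticle) (A : Operator OneParticle) (τ : ℝ) :
    Fock V →L[ℂ] Fock V :=
  functionOf (scale (τ⁻¹ : ℝ) (secondQuantization V A)) fun e => Real.exp (-e)

/-- The Gibbs state `e^{-dΓ(A)/τ} / Tr e^{-dΓ(A)/τ}` on the Fock space over `V`. -/
def gibbsState (V : Submodule ℂ OneParticle) (A : Operator OneParticle) (τ : ℝ) :
    Fock V →L[ℂ] Fock V :=
  (trace (gibbsWeight V A τ))⁻¹ • gibbsWeight V A τ

/-- `f(𝒩 / τ)` on the Fock space over `V`. -/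
def massCutoff (V : Submodule ℂ OneParticle) (f : ℝ → ℝ) (τ : ℝ) : Fock V →L[ℂ] Fock V :=
  functionOf (scale (τ⁻¹ : ℝ) (number V)) f

/-- `e^{-ℍ_{τ,0}}` on `𝔉(𝔥)`, with `ℍ_{τ,0} = dΓ(h) / τ`. -/
def freeWeight (τ : ℝ) : Fock ⊤ →L[ℂ] Fock ⊤ := gibbsWeight ⊤ oneBody τ

/-- The free Gibbs state `Γ_{τ,0}` on `𝔉(𝔥)`. -/
def freeState (τ : ℝ) : Fock ⊤ →L[ℂ] Fock ⊤ := gibbsState ⊤ oneBody τ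

/-- The low-energy space `P𝔥`, for `P = 1(h ≤ Λ)`. -/
def lowSpace (Λ : ℝ) : Submodule ℂ OneParticle :=
  LinearMap.range (lowProj Λ : OneParticle →ₗ[ℂ] OneParticle)

/-- `e^{-dΓ(PhP)/τ}` on `𝔉(P𝔥)`, for `P = 1(h ≤ Λ)`. -/
def lowWeight (Λ τ : ℝ) : Fock (lowSpace Λ) →L[ℂ] Fock (lowSpace Λ) :=
  gibbsWeight (lowSpace Λ) (compress (lowProj Λ) oneBody) τ

/-- The free Gibbs state `Γ_{τ,0,P}` on `𝔉(P𝔥)`, for `P = 1(h ≤ Λ)`. -/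
def lowState (Λ τ : ℝ) : Fock (lowSpace Λ) →L[ℂ] Fock (lowSpace Λ) :=
  gibbsState (lowSpace Λ) (compress (lowProj Λ) oneBody) τ

/-! ### Cutoff functions -/

/-- A family `f_η ∈ C_c^∞([0,∞); [0,1])`, `0 < η < K²/2`, of smooth approximations of the indicator
function of `[0, K²)`. Functions on `[0,∞)` are represented by functions on `ℝ` whose values on
`(-∞, 0)` are irrelevant. -/
structure IsCutoffFamily (K : ℝ) (f : ℝ → ℝ → ℝ) : Prop where
  contDiffOn : ∀ η ∈ Set.Ioo 0 (K ^ 2 / 2), ContDiffOn ℝ ∞ (f η) (Set.Ici 0)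
  mem_Icc : ∀ η ∈ Set.Ioo 0 (K ^ 2 / 2), ∀ s, 0 ≤ s → f η s ∈ Set.Icc (0 : ℝ) 1
  nontrivial : ∀ η ∈ Set.Ioo 0 (K ^ 2 / 2), ∃ s, 0 ≤ s ∧ f η s ≠ 0
  eq_one : ∀ η ∈ Set.Ioo 0 (K ^ 2 / 2), ∀ s, 0 ≤ s → s ≤ K ^ 2 - η → f η s = 1
  eq_zero : ∀ η ∈ Set.Ioo 0 (K ^ 2 / 2), ∀ s, K ^ 2 < s → f η s = 0
  deriv_bound : ∀ j : ℕ, 1 ≤ j → ∃ c : ℝ, ∀ η ∈ Set.Ioo 0 (K ^ 2 / 2), ∀ s, 0 ≤ s →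
    |iteratedDerivWithin j (f η) (Set.Ici 0) s| ≤ c * η⁻¹ ^ j
  tendsto_indicator : ∀ s, 0 ≤ s →
    Tendsto (fun η => f η s) (𝓝[>] 0) (𝓝 (Set.indicator (Set.Ico 0 (K ^ 2)) 1 s))

/-- `g ∈ C_c^∞([0,∞); ℝ₊)`, represented by a function on `ℝ` whose values on `(-∞, 0)` are
irrelevant. -/
structure IsSmoothCutoff (g : ℝ → ℝ) : Prop where
  contDiffOn : ContDiffOn ℝ ∞ g (Set.Ici 0)
  nonneg : ∀ s, 0 ≤ s → 0 ≤ g s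
  compact_support : ∃ R : ℝ, ∀ s, R < s → g s = 0

end FreeGibbs

end

/-! The quantum and the classical mass can be realised on one probability space, where they are
close in mean.

In the occupation number basis the free Gibbs state is diagonal, so a trace against a function of
the number operator is an expectation over independent geometric variables `n_k` with ratio
`e^{-λ_k/τ}`. For a standard complex Gaussian `z`, `|z|²` is exponentially distributed, hence
`⌊τ|z|²/λ⌋` has exactly the geometric law with ratio `e^{-λ/τ}` (`stdGaussian_occupation`). Taking
`n_k = ⌊τ|g_k|²/λ_k⌋` with the coordinates `g_k` of the free field turns the trace into the
expectation of `f(τ⁻¹ ∑ n_k)` and the classical integral into that of `f(∑ |g_k|²/λ_k)`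
(`hasSum_integral_quantumMass`, `integral_freeMeasure`).

In each mode the two masses differ by at most `min(1/τ, |g_k|²/λ_k)`. Neither bound suffices alone:
the first is not summable in `k`, the second does not decay in `τ`. The weighted geometric mean
`τ^{-1/3} (|g_k|²/λ_k)^{2/3}` does both, because `∑ λ_k^{-2/3} < ∞` (`mass_sub_occupation_le`). A
function with Lipschitz constant `L` therefore has expectations within `L τ^{-1/3} D`, where `D`
depends neither on `f` nor on the set of modes (`abs_integral_quantumMass_sub_le`). For the cutoffs
`L` is of order `η⁻¹`, at most a small power of `τ` in the stated regimes.

The operator side consists in diagonalising the second quantization and the number operator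
simultaneously in a Hilbert basis indexed by multisets of momenta (`fockBasis`). The full and the
projected problem differ only in the set `S` of admissible momenta, and `IsModeSystem` treats them
together. -/

noncomputable section

namespace FreeGibbs

/-! ### Operators diagonal in a Hilbert basis: functional calculus and trace -/

section Diagonal

variable {E ι : Type*} [NormedAddCommGroup E] [InnerProductSpace ℂ E]

theorem memℓp_mul_of_bounded {t : ι → ℝ} {C : ℝ} (ht : ∀ i, |t i| ≤ C) (x : lp (fun _ : ι => ℂ) 2) :
    Memℓp (fun i => (t i : ℂ) * x i) 2 := by
  have h := (lp.memℓp x).summable (by norm_num)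
  refine memℓp_gen (Summable.of_nonneg_of_le (fun i => by positivity) (fun i => ?_)
    (h.mul_left (C ^ 2)))
  simp only [ENNReal.toReal_ofNat, Real.rpow_ofNat, norm_mul, mul_pow, Complex.norm_real,
    Real.norm_eq_abs]
  gcongr
  exact ht i

theorem norm_mul_of_bounded_le {t : ι → ℝ} {C : ℝ} (hC : 0 ≤ C) (ht : ∀ i, |t i| ≤ C)
    (x : lp (fun _ : ι => ℂ) 2) :
    ‖(⟨fun i => (t i : ℂ) * x i, memℓp_mul_of_bounded ht x⟩ : lp (fun _ : ι => ℂ) 2)‖ ≤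
      C * ‖x‖ := by
  have h := (lp.memℓp x).summable (by norm_num)
  refine lp.norm_le_of_forall_sum_le (by norm_num) (by positivity) fun s => ?_
  have h1 : ∑ i ∈ s, ‖x i‖ ^ (2 : ENNReal).toReal ≤ ‖x‖ ^ (2 : ENNReal).toReal :=
    lp.sum_rpow_le_norm_rpow (by norm_num) x s
  simp only [ENNReal.toReal_ofNat, Real.rpow_ofNat, norm_mul, mul_pow, Complex.norm_real,
    Real.norm_eq_abs] at h1 ⊢
  calc ∑ i ∈ s, |t i| ^ 2 * ‖x i‖ ^ 2 ≤ ∑ i ∈ s, C ^ 2 * ‖x i‖ ^ 2 := by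
        gcongr with i _
        exact ht i
    _ ≤ C ^ 2 * ‖x‖ ^ 2 := by
        rw [← Finset.mul_sum]
        gcongr

/-- The bounded operator with eigenvectors `b i` and eigenvalues `t i`. -/
def diagonal (b : HilbertBasis ι ℂ E) (t : ι → ℝ) (ht : ∃ C, ∀ i, |t i| ≤ C) : E →L[ℂ] E :=
  LinearMap.mkContinuous
    { toFun := fun ψ => b.repr.symm
        ⟨fun i => (t i : ℂ) * b.repr ψ i, memℓp_mul_of_bounded ht.choose_spec _⟩
      map_add' := by
        intro x y
        rw [← map_add]
        congr 1
        ext i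
        simp only [map_add, lp.coeFn_add, Pi.add_apply, mul_add]
      map_smul' := by
        intro c x
        rw [RingHom.id_apply, ← map_smul]
        congr 1
        ext i
        simp [mul_left_comm] } (max ht.choose 0) (by
    intro x
    simp only [LinearMap.coe_mk, AddHom.coe_mk, LinearIsometryEquiv.norm_map]
    have h := norm_mul_of_bounded_le (le_max_right ht.choose 0)
      (fun i => (ht.choose_spec i).trans (le_max_left _ _)) (b.repr x)
    rwa [LinearIsometryEquiv.norm_map] at h)

theorem repr_diagonal (b : HilbertBasis ι ℂ E) (t : ι → ℝ) (ht : ∃ C, ∀ i, |t i| ≤ C) (ψ : E)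
    (i : ι) : b.repr (diagonal b t ht ψ) i = t i * b.repr ψ i := by
  simp [diagonal]

theorem inner_diagonal (b : HilbertBasis ι ℂ E) (t : ι → ℝ) (ht : ∃ C, ∀ i, |t i| ≤ C) (ψ : E)
    (i : ι) : ⟪b i, diagonal b t ht ψ⟫_ℂ = t i * ⟪b i, ψ⟫_ℂ := by
  simpa only [HilbertBasis.repr_apply_apply] using repr_diagonal b t ht ψ i

theorem hasSum_diagonal (b : HilbertBasis ι ℂ E) (t : ι → ℝ) (ht : ∃ C, ∀ i, |t i| ≤ C) (ψ : E) :
    HasSum (fun i => (t i * ⟪b i, ψ⟫_ℂ) • b i) (diagonal b t ht ψ) := by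
  simpa only [HilbertBasis.repr_apply_apply, inner_diagonal] using
    b.hasSum_repr (diagonal b t ht ψ)

theorem HilbertBasis.ext_inner (b : HilbertBasis ι ℂ E) {x y : E}
    (h : ∀ i, ⟪b i, x⟫_ℂ = ⟪b i, y⟫_ℂ) : x = y := by
  apply b.repr.injective
  ext i
  simpa only [HilbertBasis.repr_apply_apply] using h i

theorem hasSum_inner_diagonal (b : HilbertBasis ι ℂ E) (t : ι → ℝ) (ht : ∃ C, ∀ i, |t i| ≤ C)
    (ψ : E) : HasSum (fun i => ((t i * ‖⟪b i, ψ⟫_ℂ‖ ^ 2 : ℝ) : ℂ)) ⟪ψ, diagonal b t ht ψ⟫_ℂ := by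
  have h := (hasSum_diagonal b t ht ψ).mapL (innerSL ℂ ψ)
  refine h.congr_fun fun i => ?_
  simp only [innerSL_apply_apply, inner_smul_right]
  rw [← inner_conj_symm ψ (b i), mul_assoc, Complex.mul_conj']
  push_cast
  rfl

theorem hasSum_norm_inner_sq (b : HilbertBasis ι ℂ E) (ψ : E) :
    HasSum (fun i => ‖⟪b i, ψ⟫_ℂ‖ ^ 2) (‖ψ‖ ^ 2) := by
  have h := b.hasSum_inner_mul_inner ψ ψ
  rw [inner_self_eq_norm_sq_to_K] at h
  have h2 := Complex.hasSum_re h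
  convert h2 using 1
  · ext i
    rw [← inner_conj_symm ψ (b i), Complex.conj_mul']
    norm_cast
  · norm_cast

/-- `A` has the orthonormal basis `b` of eigenvectors with eigenvalues `β`, and is contained in the
corresponding maximal operator. -/
structure IsDiagonalizedBy (A : Operator E) (b : ι → E) (β : ι → ℝ) : Prop where
  mem : ∀ i, (b i, (β i : ℂ) • b i) ∈ A
  inner_eq : ∀ p ∈ A, ∀ i, ⟪b i, p.2⟫_ℂ = β i * ⟪b i, p.1⟫_ℂ

theorem IsDiagonalizedBy.scale {A : Operator E} {b : ι → E} {β : ι → ℝ}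
    (h : IsDiagonalizedBy A b β) (c : ℝ) :
    IsDiagonalizedBy (scale (c : ℂ) A) b fun i => c * β i := by
  refine ⟨fun i => ?_, ?_⟩
  · refine Submodule.mem_map.mpr ⟨_, h.mem i, ?_⟩
    simp only [LinearMap.prodMap_apply, LinearMap.id_coe, id_eq, LinearMap.smul_apply, smul_smul,
      Complex.ofReal_mul]
  · rintro p hp i
    obtain ⟨q, hq, rfl⟩ := Submodule.mem_map.mp hp
    simp [h.inner_eq q hq i, mul_assoc]


theorem diagonal_nonneg (b : HilbertBasis ι ℂ E) {t : ι → ℝ} (ht : ∃ C, ∀ i, |t i| ≤ C)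
    (h0 : ∀ i, 0 ≤ t i) : 0 ≤ diagonal b t ht := by
  rw [ContinuousLinearMap.nonneg_iff_isPositive, ContinuousLinearMap.isPositive_iff_complex]
  intro ψ
  have h : ⟪ψ, diagonal b t ht ψ⟫_ℂ = ((∑' i, t i * ‖⟪b i, ψ⟫_ℂ‖ ^ 2 : ℝ) : ℂ) := by
    rw [← (hasSum_inner_diagonal b t ht ψ).tsum_eq, Complex.ofReal_tsum]
  rw [← inner_conj_symm, h, Complex.conj_ofReal]
  exact ⟨rfl, tsum_nonneg fun i => mul_nonneg (h0 i) (by positivity)⟩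

/-- The double family `t i * |⟨b i, e j⟩|²` is nonnegative, so its sums may be exchanged: over `j`
Parseval gives `t i`, over `i` one gets `⟨e j, T e j⟩`. The sum is thus the same in every basis `e`,
including the one chosen in `trace`. -/
theorem hasSum_trace_diagonal {κ : Type*} (b : HilbertBasis ι ℂ E) {t : ι → ℝ}
    (ht : ∃ C, ∀ i, |t i| ≤ C) (h0 : ∀ i, 0 ≤ t i) {s : ℝ} (hs : HasSum t s)
    (e : HilbertBasis κ ℂ E) :
    HasSum (fun j => ⟪e j, diagonal b t ht (e j)⟫_ℂ) (s : ℂ) := by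
  have hrow : ∀ i, HasSum (fun j => t i * ‖⟪b i, e j⟫_ℂ‖ ^ 2) (t i) := by
    intro i
    have h := (hasSum_norm_inner_sq e (b i)).mul_left (t i)
    rw [b.orthonormal.1 i, one_pow, mul_one] at h
    refine h.congr_fun fun j => ?_
    rw [norm_inner_symm]
  have hsum : Summable fun p : ι × κ => t p.1 * ‖⟪b p.1, e p.2⟫_ℂ‖ ^ 2 := by
    rw [summable_prod_of_nonneg (fun p => mul_nonneg (h0 _) (by positivity))]
    exact ⟨fun i => (hrow i).summable, by simpa only [(hrow _).tsum_eq] using hs.summable⟩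
  have htot : HasSum (fun p : ι × κ => t p.1 * ‖⟪b p.1, e p.2⟫_ℂ‖ ^ 2) s := by
    have := hsum.hasSum
    rwa [← hs.unique (this.prod_fiberwise hrow)] at this
  have hswap := ((Equiv.prodComm κ ι).hasSum_iff).mpr htot
  have hC : HasSum (fun p : κ × ι => ((t p.2 * ‖⟪b p.2, e p.1⟫_ℂ‖ ^ 2 : ℝ) : ℂ)) (s : ℂ) :=
    Complex.hasSum_ofReal.mpr hswap
  exact hC.prod_fiberwise fun j => hasSum_inner_diagonal b t ht (e j)

variable [CompleteSpace E]

theorem isTraceClass_diagonal (b : HilbertBasis ι ℂ E) {t : ι → ℝ}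
    (ht : ∃ C, ∀ i, |t i| ≤ C) (h0 : ∀ i, 0 ≤ t i) (hs : Summable t) :
    IsTraceClass (diagonal b t ht) := by
  obtain ⟨w, e, -⟩ := exists_hilbertBasis ℂ E
  refine ⟨w, e, ?_⟩
  rw [CFC.abs_of_nonneg _ (diagonal_nonneg b ht h0)]
  exact (hasSum_trace_diagonal b ht h0 hs.hasSum e).summable

theorem trace_diagonal (b : HilbertBasis ι ℂ E) {t : ι → ℝ}
    (ht : ∃ C, ∀ i, |t i| ≤ C) (h0 : ∀ i, 0 ≤ t i) {s : ℝ} (hs : HasSum t s) :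
    trace (diagonal b t ht) = s :=
  (hasSum_trace_diagonal b ht h0 hs _).tsum_eq

/-- The exact domain of `A` is not needed. By `mem`, `b i` is an eigenvector for `β i`; by
`inner_eq`, the closed eigenspace for any other value is orthogonal to `b i`. So each
eigenprojection is the basis expansion restricted to a fibre of `β`, and both sums are regroupings
along these fibres. -/
theorem IsDiagonalizedBy.isFunctionOf {A : Operator E} {b : HilbertBasis ι ℂ E} {β : ι → ℝ}
    (h : IsDiagonalizedBy A b β) (F : ℝ → ℝ) (hF : ∃ C, ∀ i, |F (β i)| ≤ C) :
    IsFunctionOf A F (diagonal b (fun i => F (β i)) hF) := by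
  intro ψ
  have hmem : ∀ (e : ℝ) i, β i = e → b i ∈ eigenspace A e := by
    rintro e i rfl
    exact h.mem i
  have horth : ∀ (e : ℝ), ∀ x ∈ (eigenspace A e).topologicalClosure, ∀ i, β i ≠ e →
      ⟪b i, x⟫_ℂ = 0 := by
    intro e x hx i hi
    have hcl : IsClosed {x : E | ⟪b i, x⟫_ℂ = 0} :=
      isClosed_eq (by fun_prop) continuous_const
    refine closure_minimal (s := (eigenspace A e : Set E)) (fun y hy => ?_) hcl hx
    have h1 := h.inner_eq _ (show (y, (e : ℂ) • y) ∈ A from hy) i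
    simp only [inner_smul_right] at h1
    have h2 : ((e : ℂ) - β i) * ⟪b i, y⟫_ℂ = 0 := by rw [sub_mul, h1, sub_self]
    rcases mul_eq_zero.mp h2 with h3 | h3
    · exact absurd (by exact_mod_cast (sub_eq_zero.mp h3).symm) hi
    · exact h3
  have hproj : ∀ e : ℝ, HasSum (fun i : β ⁻¹' {e} => ⟪b i, ψ⟫_ℂ • b i) (eigenproj A e ψ) := by
    intro e
    have hs : Summable fun i : β ⁻¹' {e} => ⟪b i, ψ⟫_ℂ • b i := by
      have := (b.hasSum_repr ψ).summable
      simp only [HilbertBasis.repr_apply_apply] at this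
      exact this.subtype _
    convert hs.hasSum
    refine HilbertBasis.ext_inner b fun j => ?_
    have hin : ⟪b j, ∑' i : β ⁻¹' {e}, ⟪b i, ψ⟫_ℂ • b i⟫_ℂ =
        ∑' i : β ⁻¹' {e}, ⟪b i, ψ⟫_ℂ * ⟪b j, b i⟫_ℂ := by
      have := (hs.hasSum.mapL (innerSL ℂ (b j))).tsum_eq
      simp only [innerSL_apply_apply, inner_smul_right] at this
      exact this.symm
    rw [hin, eigenproj]
    by_cases hj : β j = e
    · rw [← Submodule.inner_starProjection_left_eq_right,
        Submodule.starProjection_eq_self_iff.mpr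
          (Submodule.le_topologicalClosure _ (hmem e j hj)),
        tsum_eq_single ⟨j, hj⟩]
      · simp [b.orthonormal.1 j]
      · intro i hi
        rw [b.orthonormal.2 fun hji => hi (Subtype.ext hji.symm), mul_zero]
    · rw [horth e _ (Submodule.starProjection_apply_mem _ _) j hj]
      refine ((tsum_congr fun i => ?_).trans tsum_zero).symm
      have hne : j ≠ i := by
        rintro rfl
        exact hj i.2
      rw [b.orthonormal.2 hne, mul_zero]
  have hsum := (b.hasSum_repr ψ)
  simp only [HilbertBasis.repr_apply_apply] at hsum
  have hsum2 := hasSum_diagonal b (fun i => F (β i)) hF ψ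
  rw [← (Equiv.sigmaFiberEquiv β).hasSum_iff] at hsum hsum2
  refine ⟨hsum.sigma fun e => hproj e, hsum2.sigma fun e => ?_⟩
  refine ((hproj e).const_smul (F e : ℂ)).congr_fun ?_
  rintro ⟨i, rfl⟩
  simp [smul_smul, Equiv.sigmaFiberEquiv]

theorem IsDiagonalizedBy.functionOf_eq {A : Operator E} {b : HilbertBasis ι ℂ E} {β : ι → ℝ}
    (h : IsDiagonalizedBy A b β) (F : ℝ → ℝ) (hF : ∃ C, ∀ i, |F (β i)| ≤ C) :
    functionOf A F = diagonal b (fun i => F (β i)) hF :=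
  FreeGibbs.functionOf_eq (h.isFunctionOf F hF)

end Diagonal

/-! ### Fourier diagonalisation of the one-body operator and of its compression -/

section OneBody

/-- The plane wave `u_k`. -/
abbrev mode (k : ℤ) : OneParticle := fourierLp 2 k

theorem inner_mode (k : ℤ) (u : OneParticle) :
    ⟪mode k, u⟫_ℂ = ∫ x in (0 : ℝ)..1, u (x : T) * fourier (-k) (x : T) := by
  have h1 := fourierBasis.repr_apply_apply u k
  rw [coe_fourierBasis] at h1
  rw [← h1, fourierBasis_repr, fourierCoeff_eq_intervalIntegral _ _ 0]
  simp [mul_comm]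

theorem periodic_fourier_coe (k : ℤ) : Function.Periodic (fun x : ℝ => fourier k (x : T)) 1 := by
  intro x
  simp only [AddCircle.coe_add, AddCircle.coe_period, add_zero]

theorem contDiff_fourier_coe (k : ℤ) : ContDiff ℝ ∞ fun x : ℝ => fourier k (x : T) := by
  simp only [fourier_coe_apply]
  exact ((contDiff_const.mul Complex.ofRealCLM.contDiff).div_const _).cexp

theorem hasDerivAt_fourier_coe (k : ℤ) (x : ℝ) :
    HasDerivAt (fun y : ℝ => fourier k (y : T))
      (2 * Real.pi * Complex.I * k * fourier k (x : T)) x := by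
  simpa using hasDerivAt_fourier 1 k x

theorem iteratedDeriv_two_fourier_coe (k : ℤ) (x : ℝ) :
    iteratedDeriv 2 (fun y : ℝ => fourier k (y : T)) x =
      (2 * Real.pi * Complex.I * k) ^ 2 * fourier k (x : T) := by
  have h : deriv (fun y : ℝ => fourier k (y : T)) =
      fun y : ℝ => 2 * Real.pi * Complex.I * k * fourier k (y : T) :=
    funext fun y => (hasDerivAt_fourier_coe k y).deriv
  rw [iteratedDeriv_succ, iteratedDeriv_one, h,
    ((hasDerivAt_fourier_coe k x).const_mul _).deriv]
  ring

theorem testOperator_fourier_coe (k : ℤ) (x : ℝ) :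
    (1 / 2 : ℂ) * (-iteratedDeriv 2 (fun y : ℝ => fourier k (y : T)) x + fourier k (x : T)) =
      eigenvalue k * fourier k (x : T) := by
  rw [iteratedDeriv_two_fourier_coe, eigenvalue]
  push_cast
  have := Complex.I_sq
  linear_combination (-2 * (Real.pi : ℂ) ^ 2 * k ^ 2 * fourier k (x : T)) * this

theorem eigenvalue_neg (k : ℤ) : eigenvalue (-k) = eigenvalue k := by
  simp [eigenvalue]

/-- Test the weak equation defining `oneBody` against the conjugate wave `fourier (-k)`. -/
theorem inner_mode_oneBody {p : OneParticle × OneParticle} (hp : p ∈ oneBody) (k : ℤ) :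
    ⟪mode k, p.2⟫_ℂ = eigenvalue k * ⟪mode k, p.1⟫_ℂ := by
  have h := hp _ (contDiff_fourier_coe (-k)) (periodic_fourier_coe (-k))
  rw [inner_mode, inner_mode, ← h, ← intervalIntegral.integral_const_mul]
  refine intervalIntegral.integral_congr fun x _ => ?_
  simp only [testOperator_fourier_coe, eigenvalue_neg]
  ring

theorem integral_mul_deriv_periodic {u u' v v' : ℝ → ℂ} (hu : ∀ x, HasDerivAt u (u' x) x)
    (hv : ∀ x, HasDerivAt v (v' x) x) (hu' : Continuous u') (hv' : Continuous v')
    (pu : Function.Periodic u 1) (pv : Function.Periodic v 1) :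
    ∫ x in (0 : ℝ)..1, u x * v' x = -∫ x in (0 : ℝ)..1, u' x * v x := by
  rw [intervalIntegral.integral_mul_deriv_eq_deriv_mul (fun x _ => hu x) (fun x _ => hv x)
    (hu'.intervalIntegrable _ _) (hv'.intervalIntegrable _ _)]
  have h1 := pu 0
  have h2 := pv 0
  rw [zero_add] at h1 h2
  rw [h1, h2, sub_self, zero_sub]

/-- Two integrations by parts move the derivatives from the test function to the plane wave;
periodicity cancels the boundary terms. -/
theorem mode_mem_oneBody (k : ℤ) : (mode k, (eigenvalue k : ℂ) • mode k) ∈ oneBody := by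
  intro φ h1 h2
  rw [integral_smul_mul]
  have hcoe : ∀ ψ : ℝ → ℂ, ∫ x in (0 : ℝ)..1, mode k (x : T) * ψ x =
      ∫ x in (0 : ℝ)..1, fourier k (x : T) * ψ x := by
    intro ψ
    refine intervalIntegral.integral_congr_ae_restrict ?_
    filter_upwards [ae_comp_coe (coeFn_fourierLp 2 k)] with x hx
    rw [hx]
  rw [hcoe, hcoe]
  have hφ : ∀ x, HasDerivAt φ (deriv φ x) x := fun x =>
    (h1.differentiable (by norm_num) x).hasDerivAt
  have h1' : ContDiff ℝ ∞ (deriv φ) := ((contDiff_infty_iff_deriv).mp h1).2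
  have hφ' : ∀ x, HasDerivAt (deriv φ) (iteratedDeriv 2 φ x) x := by
    intro x
    rw [iteratedDeriv_succ, iteratedDeriv_one]
    exact (h1'.differentiable (by norm_num) x).hasDerivAt
  have hc2 : Continuous (iteratedDeriv 2 φ) := h1.continuous_iteratedDeriv 2 (by norm_cast)
  have h2' : Function.Periodic (deriv φ) 1 := by
    intro x
    rw [← deriv_comp_add_const]
    exact congrArg (fun g => deriv g x) (funext h2)
  have hfc := (contDiff_fourier_coe k).continuous
  set c : ℂ := 2 * Real.pi * Complex.I * k with hc
  have e1 := integral_mul_deriv_periodic (hasDerivAt_fourier_coe k) hφ' (by fun_prop) hc2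
    (periodic_fourier_coe k) h2'
  have e2 := integral_mul_deriv_periodic (hasDerivAt_fourier_coe k) hφ (by fun_prop)
    h1'.continuous (periodic_fourier_coe k) h2
  simp only [mul_assoc c, ← hc] at e1 e2
  rw [intervalIntegral.integral_const_mul] at e1 e2
  have hsplit : ∫ x in (0 : ℝ)..1, fourier k (x : T) *
      ((1 / 2 : ℂ) * (-iteratedDeriv 2 φ x + φ x)) =
      (1 / 2 : ℂ) * (-(∫ x in (0 : ℝ)..1, fourier k (x : T) * iteratedDeriv 2 φ x) +
        ∫ x in (0 : ℝ)..1, fourier k (x : T) * φ x) := by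
    rw [← intervalIntegral.integral_neg, ← intervalIntegral.integral_add,
      ← intervalIntegral.integral_const_mul]
    · refine intervalIntegral.integral_congr fun x _ => ?_
      ring
    · exact ((hfc.mul hc2).neg).intervalIntegrable _ _
    · exact (hfc.mul h1.continuous).intervalIntegrable _ _
  rw [hsplit, e1, e2, hc, eigenvalue]
  push_cast
  have := Complex.I_sq
  linear_combination (-2 * (Real.pi : ℂ) ^ 2 * k ^ 2 *
    (∫ x in (0 : ℝ)..1, fourier k (x : T) * φ x)) * this

theorem oneBody_isDiagonalizedBy :
    IsDiagonalizedBy oneBody (fourierBasis : HilbertBasis ℤ ℂ OneParticle) eigenvalue := by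
  rw [coe_fourierBasis]
  exact ⟨mode_mem_oneBody, fun p hp k => inner_mode_oneBody hp k⟩

/-- The momenta `k` with `λ_k ≤ Λ`. -/
def lowModes (Λ : ℝ) : Set ℤ := {k | eigenvalue k ≤ Λ}

theorem inner_lowProj (Λ : ℝ) (u : OneParticle) (k : ℤ) :
    ⟪mode k, lowProj Λ u⟫_ℂ = (lowModes Λ).indicator (fun k => ⟪mode k, u⟫_ℂ) k := by
  have hF : ∃ C : ℝ, ∀ i, |Set.indicator (Set.Iic Λ) (1 : ℝ → ℝ) (eigenvalue i)| ≤ C := by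
    refine ⟨1, fun i => ?_⟩
    by_cases h : eigenvalue i ∈ Set.Iic Λ <;> simp [h]
  have h := inner_diagonal (fourierBasis : HilbertBasis ℤ ℂ OneParticle) _ hF u k
  rw [← oneBody_isDiagonalizedBy.functionOf_eq, coe_fourierBasis] at h
  rw [lowProj, h]
  by_cases hk : eigenvalue k ≤ Λ <;> simp [lowModes, hk, Set.indicator]

theorem ext_inner_mode {u v : OneParticle} (h : ∀ k, ⟪mode k, u⟫_ℂ = ⟪mode k, v⟫_ℂ) : u = v := by
  refine HilbertBasis.ext_inner (fourierBasis : HilbertBasis ℤ ℂ OneParticle) fun k => ?_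
  rw [coe_fourierBasis]
  exact h k

theorem inner_mode_mode (j k : ℤ) : ⟪mode j, mode k⟫_ℂ = if j = k then 1 else 0 :=
  orthonormal_iff_ite.mp orthonormal_fourier j k

/-- The space `V` is contained in the closed span of the plane waves with momenta in `S` and
contains those; the operator `A` acts on them as the one-body operator. -/
structure IsModeSystem (S : Set ℤ) (V : Submodule ℂ OneParticle) (A : Operator OneParticle) :
    Prop where
  mode_mem : ∀ k ∈ S, mode k ∈ V
  inner_eq_zero : ∀ v ∈ V, ∀ k ∉ S, ⟪mode k, v⟫_ℂ = 0
  eigen_mem : ∀ k ∈ S, (mode k, (eigenvalue k : ℂ) • mode k) ∈ A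
  inner_eq : ∀ p ∈ A, ∀ k ∈ S, ⟪mode k, p.2⟫_ℂ = eigenvalue k * ⟪mode k, p.1⟫_ℂ

theorem isModeSystem_oneBody : IsModeSystem Set.univ ⊤ oneBody :=
  ⟨fun _ _ => trivial, fun _ _ _ hk => absurd trivial hk, fun k _ => mode_mem_oneBody k,
    fun _ hp k _ => inner_mode_oneBody hp k⟩

theorem lowProj_mode {Λ : ℝ} {k : ℤ} (hk : k ∈ lowModes Λ) : lowProj Λ (mode k) = mode k := by
  classical
  refine ext_inner_mode fun j => ?_
  rw [inner_lowProj, Set.indicator_apply, inner_mode_mode]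
  split_ifs with h1 h2 h2
  · rfl
  · rfl
  · exact absurd (h2 ▸ hk) h1
  · rfl

theorem isModeSystem_low (Λ : ℝ) :
    IsModeSystem (lowModes Λ) (lowSpace Λ) (compress (lowProj Λ) oneBody) := by
  refine ⟨fun k hk => ⟨mode k, lowProj_mode hk⟩, ?_, fun k hk => ?_, ?_⟩
  · rintro _ ⟨u, rfl⟩ k hk
    exact (inner_lowProj Λ u k).trans (Set.indicator_of_notMem hk _)
  · refine Submodule.mem_map.mpr ⟨_, ⟨mode_mem_oneBody k, ⟨mode k, lowProj_mode hk⟩, trivial⟩, ?_⟩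
    refine Prod.ext rfl ?_
    change lowProj Λ ((eigenvalue k : ℂ) • mode k) = _
    rw [map_smul, lowProj_mode hk]
  · rintro _ hp k hk
    obtain ⟨q, ⟨hq, -⟩, rfl⟩ := Submodule.mem_map.mp hp
    refine (inner_lowProj Λ q.2 k).trans ?_
    rw [Set.indicator_of_mem hk]
    exact inner_mode_oneBody hq k

end OneBody

/-! ### Plane waves on `𝕋ⁿ` and the `n`-particle operator -/

section Tensor

variable {n : ℕ}

/-- The tensor products of plane waves are an orthonormal basis of `L²(𝕋ⁿ)`. -/
def planeWaveBasis (n : ℕ) : HilbertBasis (Fin n → ℤ) ℂ (NParticle n) :=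
  UnitAddTorus.mFourierBasis

/-- The plane wave `u_{a₁} ⊗ ⋯ ⊗ u_{aₙ}`. -/
def planeWave (a : Fin n → ℤ) : NParticle n := planeWaveBasis n a

theorem coeFn_planeWave (a : Fin n → ℤ) :
    planeWave a =ᵐ[Measure.pi fun _ : Fin n => volT] fun x => ∏ i, fourier (a i) (x i) := by
  have h : planeWave a = UnitAddTorus.mFourierLp 2 a :=
    congrFun (UnitAddTorus.coe_mFourierBasis (d := Fin n)) a
  rw [h]
  exact UnitAddTorus.coeFn_mFourierLp 2 a

theorem inner_planeWave_planeWave (a b : Fin n → ℤ) :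
    ⟪planeWave a, planeWave b⟫_ℂ = if a = b then 1 else 0 :=
  orthonormal_iff_ite.mp (planeWaveBasis n).orthonormal a b

theorem ae_eval {p : Fin n → T → Prop} (h : ∀ i, ∀ᵐ x ∂volT, p i x) :
    ∀ᵐ x ∂(Measure.pi fun _ : Fin n => volT), ∀ i, p i (x i) :=
  ae_all_iff.mpr fun i =>
    (measurePreserving_eval (fun _ : Fin n => volT) i).quasiMeasurePreserving.ae (h i)

theorem isTensor_planeWave (a : Fin n → ℤ) : IsTensor (fun i => mode (a i)) (planeWave a) := by
  filter_upwards [coeFn_planeWave a, ae_eval fun i => coeFn_fourierLp 2 (a i)] with x h1 h2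
  rw [h1]
  exact Finset.prod_congr rfl fun i _ => (h2 i).symm

theorem inner_planeWave {f : Fin n → OneParticle} {Ψ : NParticle n} (h : IsTensor f Ψ)
    (a : Fin n → ℤ) : ⟪planeWave a, Ψ⟫_ℂ = ∏ i, ⟪mode (a i), f i⟫_ℂ := by
  simp only [L2.inner_def]
  rw [← integral_fintype_prod_eq_prod fun i (y : T) => ⟪mode (a i) y, f i y⟫_ℂ]
  refine integral_congr_ae ?_
  filter_upwards [h, isTensor_planeWave a] with x h1 h2
  simp only [RCLike.inner_apply, h1, h2, map_prod, Finset.prod_mul_distrib]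

/-- Replacing the `j`-th factor by `c` times itself is written as a product with an indicator-like
factor, a form used both for functions and for Fourier coefficients. -/
theorem prod_update_scaled {R : Type*} [CommSemiring R] (g : Fin n → R) (j : Fin n) (c : R) :
    ∏ i, (if i = j then c else 1) * g i = c * ∏ i, g i := by
  rw [Finset.prod_mul_distrib, Finset.prod_ite_eq' Finset.univ j fun _ => c,
    if_pos (Finset.mem_univ j)]

theorem isTensor_update_smul {f : Fin n → OneParticle} {Ψ : NParticle n} (h : IsTensor f Ψ)
    (j : Fin n) (c : ℂ) : IsTensor (Function.update f j (c • f j)) (c • Ψ) := by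
  have hu : ∀ i, ∀ᵐ x ∂volT, Function.update f j (c • f j) i x =
      (if i = j then c else 1) * f i x := by
    intro i
    by_cases hij : i = j
    · subst hij
      filter_upwards [Lp.coeFn_smul c (f i)] with x hx
      simp [hx]
    · simp [hij]
  filter_upwards [h, Lp.coeFn_smul c Ψ, ae_eval hu] with x h1 h2 h3
  rw [h2, Pi.smul_apply, h1, smul_eq_mul]
  simp only [h3, prod_update_scaled]

theorem compPerm_planeWave (σ : Equiv.Perm (Fin n)) (a : Fin n → ℤ) :
    Lp.compMeasurePreservingₗᵢ ℂ (fun x => x ∘ σ) (measurePreserving_perm σ) (planeWave a) =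
      planeWave (a ∘ σ.symm) := by
  refine Lp.ext ?_
  have h1 := (measurePreserving_perm σ).quasiMeasurePreserving.ae (coeFn_planeWave a)
  filter_upwards [Lp.coeFn_compMeasurePreserving (planeWave a) (measurePreserving_perm σ),
    coeFn_planeWave (a ∘ σ.symm), h1] with x h2 h3 h4
  rw [h3]
  refine (h2.trans h4).trans ?_
  exact Fintype.prod_equiv σ _ _ fun i => by simp

theorem inner_planeWave_comp_perm {Ψ : NParticle n} (h : Ψ ∈ symmetricFunctions n)
    (σ : Equiv.Perm (Fin n)) (a : Fin n → ℤ) :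
    ⟪planeWave (a ∘ σ), Ψ⟫_ℂ = ⟪planeWave a, Ψ⟫_ℂ := by
  have h1 := Submodule.mem_iInf _ |>.mp h σ.symm
  have h2 : Lp.compMeasurePreservingₗᵢ ℂ (fun x => x ∘ σ.symm) (measurePreserving_perm σ.symm) Ψ =
      Ψ := h1
  conv_rhs => rw [← LinearIsometry.inner_map_map (Lp.compMeasurePreservingₗᵢ ℂ
    (fun x : Fin n → T => x ∘ σ.symm) (measurePreserving_perm σ.symm)) (planeWave a) Ψ]
  rw [h2, compPerm_planeWave, Equiv.symm_symm]

theorem planeWave_mem_tensorPower {V : Submodule ℂ OneParticle} {a : Fin n → ℤ}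
    (h : ∀ i, mode (a i) ∈ V) : planeWave a ∈ tensorPower V n :=
  Submodule.le_topologicalClosure _ (Submodule.subset_span ⟨_, h, isTensor_planeWave a⟩)

theorem inner_planeWave_eq_zero {V : Submodule ℂ OneParticle} {a : Fin n → ℤ} {i : Fin n}
    (h : ∀ v ∈ V, ⟪mode (a i), v⟫_ℂ = 0) {Ψ : NParticle n} (hΨ : Ψ ∈ tensorPower V n) :
    ⟪planeWave a, Ψ⟫_ℂ = 0 := by
  have hle : tensorPower V n ≤ LinearMap.ker (innerSL ℂ (planeWave a) : NParticle n →ₗ[ℂ] ℂ) := by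
    refine Submodule.topologicalClosure_minimal _ (Submodule.span_le.mpr ?_)
      (innerSL ℂ (planeWave a)).isClosed_ker
    rintro Φ ⟨f, hf, hΦ⟩
    refine (inner_planeWave hΦ a).trans ?_
    exact Finset.prod_eq_zero (Finset.mem_univ i) (h _ (hf i))
  exact hle hΨ

theorem planeWave_mem_sumOperator {A : Operator OneParticle} {a : Fin n → ℤ}
    (h : ∀ i, (mode (a i), (eigenvalue (a i) : ℂ) • mode (a i)) ∈ A) :
    (planeWave a, ((∑ i, eigenvalue (a i) : ℝ) : ℂ) • planeWave a) ∈ sumOperator A n := by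
  refine Submodule.le_topologicalClosure _ (Submodule.subset_span ⟨_, _, h, isTensor_planeWave a,
    fun j => (eigenvalue (a j) : ℂ) • planeWave a,
    fun j => isTensor_update_smul (isTensor_planeWave a) j _, ?_⟩)
  simp only [← Finset.sum_smul, Complex.ofReal_sum]

/-- The identity says that `p` lies in the kernel of a continuous functional, so it passes to the
closed span and need only be checked on product vectors. There the `j`-th term contributes the
factor `eigenvalue (a j)`. -/
theorem inner_planeWave_sumOperator {A : Operator OneParticle} {a : Fin n → ℤ}
    (h : ∀ p ∈ A, ∀ i, ⟪mode (a i), p.2⟫_ℂ = eigenvalue (a i) * ⟪mode (a i), p.1⟫_ℂ)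
    {p : NParticle n × NParticle n} (hp : p ∈ sumOperator A n) :
    ⟪planeWave a, p.2⟫_ℂ = ((∑ i, eigenvalue (a i) : ℝ) : ℂ) * ⟪planeWave a, p.1⟫_ℂ := by
  let L : NParticle n × NParticle n →L[ℂ] ℂ :=
    innerSL ℂ (planeWave a) ∘L ContinuousLinearMap.snd ℂ _ _ -
      ((∑ i, eigenvalue (a i) : ℝ) : ℂ) •
        (innerSL ℂ (planeWave a) ∘L ContinuousLinearMap.fst ℂ _ _)
  have hle : sumOperator A n ≤ LinearMap.ker (L : NParticle n × NParticle n →ₗ[ℂ] ℂ) := by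
    refine Submodule.topologicalClosure_minimal _ (Submodule.span_le.mpr ?_) L.isClosed_ker
    rintro q ⟨f, g, hfg, hq, Ψ, hΨ, hsum⟩
    change ⟪planeWave a, q.2⟫_ℂ - ((∑ i, eigenvalue (a i) : ℝ) : ℂ) * ⟪planeWave a, q.1⟫_ℂ = 0
    rw [hsum, inner_sum, inner_planeWave hq, sub_eq_zero, Complex.ofReal_sum, Finset.sum_mul]
    refine Finset.sum_congr rfl fun j _ => ?_
    rw [inner_planeWave (hΨ j), ← prod_update_scaled _ j]
    refine Finset.prod_congr rfl fun i _ => ?_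
    by_cases hij : i = j
    · subst hij
      simpa using h _ (hfg i) i
    · simp [hij]
  exact sub_eq_zero.mp (show L p = 0 from hle hp)

end Tensor

/-! ### Multisets as permutation classes of labelings -/

section Occupation

variable {α : Type*} {n : ℕ}

/-- Equal multisets of values mean fibres of equal cardinality; bijections between the fibres glue
to a permutation. -/
theorem exists_perm_of_map_eq {a b : Fin n → α}
    (h : Finset.univ.val.map a = Finset.univ.val.map b) : ∃ σ : Equiv.Perm (Fin n), b ∘ σ = a := by
  classical
  have hc : ∀ c, Nonempty ({i // a i = c} ≃ {i // b i = c}) := by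
    intro c
    have h1 := congrArg (Multiset.count c) h
    rw [Multiset.count_map, Multiset.count_map] at h1
    refine ⟨Fintype.equivOfCardEq ?_⟩
    rw [Fintype.card_subtype, Fintype.card_subtype]
    simp only [eq_comm (a := c)] at h1
    exact h1
  exact ⟨Equiv.ofFiberEquiv fun c => (hc c).some, funext fun i => Equiv.ofFiberEquiv_map _ i⟩

theorem finite_labelings (m : Multiset α) (n : ℕ) :
    {a : Fin n → α | Finset.univ.val.map a = m}.Finite := by
  classical
  refine (Set.Finite.pi' fun _ : Fin n => m.toFinset.finite_toSet).subset ?_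
  rintro a rfl i
  simp

/-- The maps `Fin n → α` that take the values in `m`, with multiplicities. -/
def labelings (m : Multiset α) (n : ℕ) : Finset (Fin n → α) := (finite_labelings m n).toFinset

theorem mem_labelings {m : Multiset α} {a : Fin n → α} :
    a ∈ labelings m n ↔ Finset.univ.val.map a = m := by
  simp [labelings]

theorem labelings_eq_empty {m : Multiset α} (h : n ≠ m.card) : labelings m n = ∅ := by
  refine Finset.eq_empty_of_forall_notMem fun a ha => h ?_
  rw [← mem_labelings.mp ha]
  simp

theorem labelings_nonempty (m : Multiset α) : (labelings m m.card).Nonempty := by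
  obtain ⟨l, rfl⟩ : ∃ l : List α, (l : Multiset α) = m := ⟨m.toList, m.coe_toList⟩
  refine ⟨l.get, mem_labelings.mpr ?_⟩
  refine (Fin.univ_val_map (n := l.length) l.get).trans ?_
  exact congrArg _ (List.ofFn_get l)

theorem comp_perm_mem_labelings {m : Multiset α} {a : Fin n → α} (σ : Equiv.Perm (Fin n))
    (h : a ∈ labelings m n) : a ∘ σ ∈ labelings m n := by
  rw [mem_labelings] at h ⊢
  rw [← h, ← Multiset.map_map]
  congr 1
  exact congrArg Finset.val (Finset.map_univ_equiv σ)

end Occupation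

/-! ### Symmetrised plane waves -/

section SymmetricStates

variable {S : Set ℤ} {n : ℕ}

/-- The normalized symmetric state with occupation numbers `m`, if `m` has `n` elements, and zero
otherwise. -/
def symState (m : Multiset S) (n : ℕ) : NParticle n :=
  (((Real.sqrt (labelings m n).card)⁻¹ : ℝ) : ℂ) •
    ∑ a ∈ labelings m n, planeWave fun i => (a i : ℤ)

theorem symState_eq_zero {m : Multiset S} (h : n ≠ m.card) : symState m n = 0 := by
  rw [symState, labelings_eq_empty h, Finset.sum_empty, smul_zero]

theorem inner_symState (m : Multiset S) (Ψ : NParticle n) :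
    ⟪symState m n, Ψ⟫_ℂ = (((Real.sqrt (labelings m n).card)⁻¹ : ℝ) : ℂ) *
      ∑ a ∈ labelings m n, ⟪planeWave fun i => (a i : ℤ), Ψ⟫_ℂ := by
  rw [symState, inner_smul_left, Complex.conj_ofReal, sum_inner]

theorem inner_planeWave_symState (m : Multiset S) (a : Fin n → S) [Decidable (a ∈ labelings m n)] :
    ⟪planeWave fun i => (a i : ℤ), symState m n⟫_ℂ =
      if a ∈ labelings m n then (((Real.sqrt (labelings m n).card)⁻¹ : ℝ) : ℂ) else 0 := by
  classical
  have h : ∀ b : Fin n → S, ((fun i => (a i : ℤ)) = fun i => (b i : ℤ)) ↔ a = b := fun b => by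
    simp only [funext_iff, Subtype.ext_iff]
  simp only [symState, inner_smul_right, inner_sum, inner_planeWave_planeWave, h,
    Finset.sum_ite_eq]
  split_ifs <;> simp

theorem inner_symState_self (m : Multiset S) :
    ⟪symState m m.card, symState m m.card⟫_ℂ = 1 := by
  classical
  rw [inner_symState, Finset.sum_congr rfl fun a ha =>
    (inner_planeWave_symState m a).trans (if_pos ha), Finset.sum_const, nsmul_eq_mul]
  have hpos : (0 : ℝ) < (labelings m m.card).card := by
    exact_mod_cast (labelings_nonempty m).card_pos
  have h : (Real.sqrt (labelings m m.card).card)⁻¹ *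
      ((labelings m m.card).card * (Real.sqrt (labelings m m.card).card)⁻¹) = 1 := by
    have := Real.mul_self_sqrt hpos.le
    have h0 := (Real.sqrt_pos.mpr hpos).ne'
    field_simp
    nlinarith
  exact_mod_cast h

theorem inner_symState_of_ne {m m' : Multiset S} (h : m ≠ m') :
    ⟪symState m n, symState m' n⟫_ℂ = 0 := by
  classical
  rw [inner_symState, Finset.sum_eq_zero, mul_zero]
  intro a ha
  rw [inner_planeWave_symState, if_neg]
  intro ha'
  exact h ((mem_labelings.mp ha).symm.trans (mem_labelings.mp ha'))

theorem symState_mem_sector {V : Submodule ℂ OneParticle} (hV : ∀ k ∈ S, mode k ∈ V)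
    (m : Multiset S) (n : ℕ) : symState m n ∈ sector V n := by
  refine ⟨Submodule.smul_mem _ _ (Submodule.sum_mem _ fun a _ =>
    planeWave_mem_tensorPower fun i => hV _ (a i).2), ?_⟩
  refine (Submodule.mem_iInf _).mpr fun σ => ?_
  change Lp.compMeasurePreservingₗᵢ ℂ (fun x => x ∘ σ) (measurePreserving_perm σ) (symState m n) =
    symState m n
  rw [symState, map_smul, map_sum]
  congr 1
  simp only [compPerm_planeWave]
  refine Finset.sum_nbij' (fun a => a ∘ σ.symm) (fun a => a ∘ σ)
    (fun a ha => comp_perm_mem_labelings _ ha) (fun a ha => comp_perm_mem_labelings _ ha) ?_ ?_ ?_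
  · intro a _
    ext i
    simp
  · intro a _
    ext i
    simp
  · intro a _
    rfl

/-- A symmetric function has the same coefficient along all labelings of one multiset, since these
are permutations of each other. Its product with `symState m n` is therefore a nonzero multiple of
that common coefficient. -/
theorem inner_planeWave_eq_zero_of_symState {Ψ : NParticle n} (hs : Ψ ∈ symmetricFunctions n)
    (h : ∀ m : Multiset S, ⟪symState m n, Ψ⟫_ℂ = 0) (a : Fin n → S) :
    ⟪planeWave fun i => (a i : ℤ), Ψ⟫_ℂ = 0 := by
  set m : Multiset S := Finset.univ.val.map a with hm
  have ha : a ∈ labelings m n := mem_labelings.mpr rfl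
  have h1 := h m
  rw [inner_symState, Finset.sum_congr rfl (g := fun _ => ⟪planeWave fun i => (a i : ℤ), Ψ⟫_ℂ),
    Finset.sum_const, nsmul_eq_mul] at h1
  · have hpos : (0 : ℝ) < (labelings m n).card := by exact_mod_cast Finset.card_pos.mpr ⟨a, ha⟩
    have h2 := (Real.sqrt_pos.mpr hpos).ne'
    simpa [h2, hpos.ne', Finset.ne_empty_of_mem ha] using h1
  · intro b hb
    obtain ⟨σ, hσ⟩ := exists_perm_of_map_eq ((mem_labelings.mp hb).trans hm)
    rw [← hσ]
    exact inner_planeWave_comp_perm hs σ fun i => (a i : ℤ)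

/-- The energy `∑_{k ∈ m} λ_k`. -/
def energy (m : Multiset S) : ℝ := (m.map fun k : S => eigenvalue k).sum

theorem sum_eigenvalue_of_mem_labelings {m : Multiset S} {a : Fin n → S} (h : a ∈ labelings m n) :
    ∑ i, eigenvalue (a i) = energy m := by
  rw [energy, ← mem_labelings.mp h, Multiset.map_map]
  rfl

theorem symState_mem_sumOperator {A : Operator OneParticle}
    (hA : ∀ k ∈ S, (mode k, (eigenvalue k : ℂ) • mode k) ∈ A) (m : Multiset S) (n : ℕ) :
    (symState m n, (energy m : ℂ) • symState m n) ∈ sumOperator A n := by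
  have h : ∀ a ∈ labelings m n, (planeWave fun i => (a i : ℤ),
      (energy m : ℂ) • planeWave fun i => (a i : ℤ)) ∈ sumOperator A n := by
    intro a ha
    rw [← sum_eigenvalue_of_mem_labelings ha]
    exact planeWave_mem_sumOperator fun i => hA _ (a i).2
  have h1 := (sumOperator A n).smul_mem (((Real.sqrt (labelings m n).card)⁻¹ : ℝ) : ℂ)
    ((sumOperator A n).sum_mem h)
  convert h1 using 1
  ext1
  · simp only [symState, Prod.smul_fst, Prod.fst_sum]
  · simp only [symState, Prod.smul_snd, Prod.snd_sum, ← Finset.smul_sum]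
    rw [smul_comm]

theorem inner_symState_sumOperator {A : Operator OneParticle}
    (hA : ∀ p ∈ A, ∀ k ∈ S, ⟪mode k, p.2⟫_ℂ = eigenvalue k * ⟪mode k, p.1⟫_ℂ)
    {p : NParticle n × NParticle n} (hp : p ∈ sumOperator A n) (m : Multiset S) :
    ⟪symState m n, p.2⟫_ℂ = energy m * ⟪symState m n, p.1⟫_ℂ := by
  rw [inner_symState, inner_symState, mul_left_comm]
  refine congrArg _ ?_
  rw [Finset.mul_sum]
  refine Finset.sum_congr rfl fun a ha => ?_
  rw [inner_planeWave_sumOperator (fun q hq i => hA q hq _ (a i).2) hp,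
    sum_eigenvalue_of_mem_labelings ha]

end SymmetricStates

/-! ### The occupation number basis diagonalises both operators -/

section FockBasis

variable {S : Set ℤ} {V : Submodule ℂ OneParticle}

/-- The state of Fock space with occupation numbers `m`. -/
def fockState (hV : ∀ k ∈ S, mode k ∈ V) (m : Multiset S) : Fock V :=
  lp.single 2 m.card ⟨symState m m.card, symState_mem_sector hV m _⟩

/-- The value zero of `symState m n` for `n ≠ m.card` makes one formula valid in all sectors. -/
theorem fockState_apply (hV : ∀ k ∈ S, mode k ∈ V) (m : Multiset S) (n : ℕ) :
    (fockState hV m n : NParticle n) = symState m n := by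
  rw [fockState, lp.single_apply]
  by_cases h : n = m.card
  · subst h
    rw [Pi.single_eq_same]
  · rw [Pi.single_eq_of_ne h, symState_eq_zero h, Submodule.coe_zero]

theorem inner_fockState (hV : ∀ k ∈ S, mode k ∈ V) (m : Multiset S) (Φ : Fock V) :
    ⟪fockState hV m, Φ⟫_ℂ = ⟪symState m m.card, (Φ m.card : NParticle m.card)⟫_ℂ := by
  rw [fockState, lp.inner_single_left, Submodule.coe_inner]

theorem orthonormal_fockState (hV : ∀ k ∈ S, mode k ∈ V) : Orthonormal ℂ (fockState hV) := by
  classical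
  rw [orthonormal_iff_ite]
  intro m m'
  rw [inner_fockState, fockState_apply]
  split_ifs with h
  · rw [← h, inner_symState_self]
  · exact inner_symState_of_ne h

/-- Completeness: in each sector, plane-wave coefficients with all momenta in `S` vanish by
symmetry, and those with a momentum outside `S` vanish because the sector lies in the tensor power
of `V`. -/
theorem eq_zero_of_inner_fockState (hV : ∀ k ∈ S, mode k ∈ V)
    (hV' : ∀ v ∈ V, ∀ k ∉ S, ⟪mode k, v⟫_ℂ = 0) {Φ : Fock V}
    (h : ∀ m, ⟪fockState hV m, Φ⟫_ℂ = 0) : Φ = 0 := by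
  refine lp.ext (funext fun n => Subtype.ext ?_)
  have hs : ∀ m : Multiset S, ⟪symState m n, (Φ n : NParticle n)⟫_ℂ = 0 := by
    intro m
    by_cases hn : n = m.card
    · subst hn
      rw [← inner_fockState hV, h]
    · rw [symState_eq_zero hn, inner_zero_left]
  refine HilbertBasis.ext_inner (planeWaveBasis n) fun a => ?_
  change ⟪planeWave a, _⟫_ℂ = ⟪planeWave a, ((0 : sector V n) : NParticle n)⟫_ℂ
  rw [Submodule.coe_zero, inner_zero_right]
  by_cases ha : ∀ i, a i ∈ S
  · exact inner_planeWave_eq_zero_of_symState (Φ n).2.2 hs fun i => ⟨a i, ha i⟩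
  · obtain ⟨i, hi⟩ := not_forall.mp ha
    exact inner_planeWave_eq_zero (fun v hv => hV' v hv _ hi) (Φ n).2.1

/-- The occupation number basis of Fock space. -/
def fockBasis (hV : ∀ k ∈ S, mode k ∈ V) (hV' : ∀ v ∈ V, ∀ k ∉ S, ⟪mode k, v⟫_ℂ = 0) :
    HilbertBasis (Multiset S) ℂ (Fock V) :=
  HilbertBasis.mkOfOrthogonalEqBot (orthonormal_fockState hV) (by
    rw [Submodule.eq_bot_iff]
    intro Φ hΦ
    exact eq_zero_of_inner_fockState hV hV' fun m =>
      (Submodule.mem_orthogonal _ _).mp hΦ _ (Submodule.subset_span ⟨m, rfl⟩))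

theorem coe_fockBasis (hV : ∀ k ∈ S, mode k ∈ V)
    (hV' : ∀ v ∈ V, ∀ k ∉ S, ⟪mode k, v⟫_ℂ = 0) : ⇑(fockBasis hV hV') = fockState hV :=
  HilbertBasis.coe_mkOfOrthogonalEqBot _ _

theorem number_isDiagonalizedBy (hV : ∀ k ∈ S, mode k ∈ V)
    (hV' : ∀ v ∈ V, ∀ k ∉ S, ⟪mode k, v⟫_ℂ = 0) :
    IsDiagonalizedBy (number V) (fockBasis hV hV') fun m => (m.card : ℝ) := by
  rw [coe_fockBasis]
  refine ⟨fun m n => Subtype.ext ?_, fun p hp m => ?_⟩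
  · simp only [lp.coeFn_smul, Pi.smul_apply, Submodule.coe_smul, fockState_apply]
    by_cases hn : n = m.card
    · rw [hn, Complex.ofReal_natCast]
    · rw [symState_eq_zero hn, smul_zero, smul_zero]
  · rw [inner_fockState, inner_fockState, hp m.card, Submodule.coe_smul, inner_smul_right,
      Complex.ofReal_natCast]

theorem IsModeSystem.secondQuantization_isDiagonalizedBy {A : Operator OneParticle}
    (h : IsModeSystem S V A) :
    IsDiagonalizedBy (secondQuantization V A) (fockBasis h.mode_mem h.inner_eq_zero) energy := by
  rw [coe_fockBasis]
  refine ⟨fun m n => ?_, fun p hp m => ?_⟩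
  · simp only [lp.coeFn_smul, Pi.smul_apply, Submodule.coe_smul, fockState_apply]
    exact symState_mem_sumOperator h.eigen_mem m n
  · rw [inner_fockState, inner_fockState]
    exact inner_symState_sumOperator h.inner_eq (hp m.card) m

end FockBasis

/-! ### Traces against the Gibbs state as sums over multisets -/

section Gibbs

variable {S : Set ℤ} {V : Submodule ℂ OneParticle} {A : Operator OneParticle} {τ : ℝ}

theorem eigenvalue_pos (k : ℤ) : 0 < eigenvalue k := by
  rw [eigenvalue]
  positivity

theorem energy_nonneg (m : Multiset S) : 0 ≤ energy m := by
  refine Multiset.sum_nonneg fun x hx => ?_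
  obtain ⟨k, -, rfl⟩ := Multiset.mem_map.mp hx
  exact (eigenvalue_pos _).le

/-- The eigenvalue `e^{-E/τ}` of the Gibbs weight. -/
def boltzmann (τ : ℝ) (m : Multiset S) : ℝ := Real.exp (-(τ⁻¹ * energy m))

theorem boltzmann_nonneg (τ : ℝ) (m : Multiset S) : 0 ≤ boltzmann τ m := (Real.exp_pos _).le

theorem abs_boltzmann_le (hτ : 0 < τ) (m : Multiset S) : |boltzmann τ m| ≤ 1 := by
  rw [boltzmann, abs_of_pos (Real.exp_pos _), Real.exp_le_one_iff]
  have := energy_nonneg m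
  simp only [Left.neg_nonpos_iff]
  positivity

theorem IsModeSystem.gibbsWeight_eq (h : IsModeSystem S V A) (hτ : 0 < τ) :
    gibbsWeight V A τ = diagonal (fockBasis h.mode_mem h.inner_eq_zero) (boltzmann τ)
      ⟨1, abs_boltzmann_le hτ⟩ :=
  (h.secondQuantization_isDiagonalizedBy.scale τ⁻¹).functionOf_eq (fun e => Real.exp (-e))
    ⟨1, abs_boltzmann_le hτ⟩

theorem IsModeSystem.massCutoff_eq (h : IsModeSystem S V A) (f : ℝ → ℝ)
    (hf : ∃ C, ∀ m : Multiset S, |f (τ⁻¹ * m.card)| ≤ C) :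
    massCutoff V f τ = diagonal (fockBasis h.mode_mem h.inner_eq_zero)
      (fun m => f (τ⁻¹ * m.card)) hf :=
  ((number_isDiagonalizedBy h.mode_mem h.inner_eq_zero).scale τ⁻¹).functionOf_eq f hf

theorem IsModeSystem.isTraceClass_gibbsWeight (h : IsModeSystem S V A) (hτ : 0 < τ)
    (hs : Summable (boltzmann τ : Multiset S → ℝ)) : IsTraceClass (gibbsWeight V A τ) := by
  rw [h.gibbsWeight_eq hτ]
  exact isTraceClass_diagonal _ _ (boltzmann_nonneg τ) hs

/-- Both factors are diagonal in the same basis, so the trace is a weighted sum. The inverse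
partition function enters only as a `c` normalising the Boltzmann weights; the probabilistic side
supplies it, so no product formula is required. -/
theorem IsModeSystem.gibbsState_comp_massCutoff (h : IsModeSystem S V A) (hτ : 0 < τ) {c : ℝ}
    (hc : HasSum (fun m : Multiset S => c * boltzmann τ m) 1) {f : ℝ → ℝ} {C : ℝ}
    (hf0 : ∀ s, 0 ≤ s → 0 ≤ f s) (hf : ∀ s, 0 ≤ s → f s ≤ C) :
    IsTraceClass (gibbsState V A τ ∘L massCutoff V f τ) ∧
      trace (gibbsState V A τ ∘L massCutoff V f τ) =
        ((∑' m : Multiset S, c * boltzmann τ m * f (τ⁻¹ * m.card) : ℝ) : ℂ) := by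
  have hc0 : c ≠ 0 := by
    rintro rfl
    simp only [zero_mul] at hc
    exact zero_ne_one (hasSum_zero.unique hc)
  have hsum : HasSum (boltzmann τ : Multiset S → ℝ) c⁻¹ := by
    simpa [← mul_assoc, hc0] using hc.mul_left c⁻¹
  have hcpos : 0 < c := by
    have : 0 ≤ c⁻¹ := hsum.nonneg (boltzmann_nonneg τ)
    exact lt_of_le_of_ne (inv_nonneg.mp this) hc0.symm
  have harg : ∀ m : Multiset S, 0 ≤ τ⁻¹ * (m.card : ℝ) := fun m => by positivity
  have hfm : ∀ m : Multiset S, |f (τ⁻¹ * m.card)| ≤ C := fun m => by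
    rw [abs_of_nonneg (hf0 _ (harg m))]
    exact hf _ (harg m)
  have hbd : ∀ m : Multiset S, |c * boltzmann τ m * f (τ⁻¹ * m.card)| ≤ c * 1 * C := fun m => by
    rw [abs_mul, abs_mul, abs_of_pos hcpos]
    gcongr
    · exact abs_boltzmann_le hτ m
    · exact hfm m
  have hnn : ∀ m : Multiset S, 0 ≤ c * boltzmann τ m * f (τ⁻¹ * m.card) := fun m =>
    mul_nonneg (mul_nonneg hcpos.le (boltzmann_nonneg τ m)) (hf0 _ (harg m))
  have heq : gibbsState V A τ ∘L massCutoff V f τ =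
      diagonal (fockBasis h.mode_mem h.inner_eq_zero)
        (fun m => c * boltzmann τ m * f (τ⁻¹ * m.card)) ⟨_, hbd⟩ := by
    ext1 ψ
    refine HilbertBasis.ext_inner (fockBasis h.mode_mem h.inner_eq_zero) fun m => ?_
    rw [gibbsState, h.gibbsWeight_eq hτ, h.massCutoff_eq f ⟨C, hfm⟩,
      trace_diagonal _ _ (boltzmann_nonneg τ) hsum, inner_diagonal,
      ContinuousLinearMap.comp_apply, _root_.smul_apply, inner_smul_right,
      inner_diagonal, inner_diagonal]
    push_cast
    rw [inv_inv]
    ring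
  have hs : Summable fun m : Multiset S => c * boltzmann τ m * f (τ⁻¹ * m.card) := by
    refine Summable.of_nonneg_of_le hnn (fun m => ?_) (hc.summable.mul_right C)
    exact mul_le_mul_of_nonneg_left (hf _ (harg m)) (mul_nonneg hcpos.le (boltzmann_nonneg τ m))
  rw [heq]
  exact ⟨isTraceClass_diagonal _ _ hnn hs, trace_diagonal _ _ hnn hs.hasSum⟩

end Gibbs

/-! ### Geometric occupation numbers from Gaussian variables -/

section Occupation

theorem stdGaussian_le_norm_sq {t : ℝ} (ht : 0 ≤ t) :
    stdGaussian {z | t ≤ ‖z‖ ^ 2} = ENNReal.ofReal (Real.exp (-t)) := by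
  rcases ht.eq_or_lt with rfl | ht
  · simp
  have hmeas : MeasurableSet {z : ℂ | t ≤ ‖z‖ ^ 2} :=
    measurableSet_le measurable_const (by fun_prop)
  have hint : Integrable fun z : ℂ => 1 / Real.pi * Real.exp (-‖z‖ ^ 2) := by
    have h1 : ∫ z : ℂ, Real.exp (-1 * ‖z‖ ^ 2) ≠ 0 := by
      rw [GaussianFourier.integral_rexp_neg_mul_sq_norm one_pos]
      positivity
    simpa only [neg_one_mul] using (Integrable.of_integral_ne_zero h1).const_mul (1 / Real.pi)
  rw [stdGaussian, withDensity_apply _ hmeas, ← ofReal_integral_eq_lintegral_ofReal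
    hint.integrableOn (Eventually.of_forall fun z => by positivity)]
  congr 1
  have hset : ∀ r : ℝ, 0 < r → (t ≤ r ^ 2 ↔ r ∈ Set.Ici (Real.sqrt t)) := fun r hr => by
    rw [Set.mem_Ici, Real.sqrt_le_left hr.le]
  have hpolar := integral_fun_norm_addHaar (volume : Measure ℂ)
    (Set.indicator {r : ℝ | t ≤ r ^ 2} fun r => 1 / Real.pi * Real.exp (-r ^ 2))
  have hball : (volume : Measure ℂ).real (Metric.ball 0 1) = Real.pi := by
    simp [Measure.real, Complex.volume_ball]
  rw [Complex.finrank_real_complex, hball] at hpolar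
  rw [← integral_indicator hmeas]
  refine hpolar.trans ?_
  have hrad : ∫ y in Set.Ioi (0 : ℝ), y ^ (2 - 1) •
      Set.indicator {r : ℝ | t ≤ r ^ 2} (fun r => 1 / Real.pi * Real.exp (-r ^ 2)) y =
      ∫ y in Set.Ioi (Real.sqrt t), y * (1 / Real.pi * Real.exp (-y ^ 2)) := by
    rw [← integral_Ici_eq_integral_Ioi (x := Real.sqrt t), ← integral_indicator measurableSet_Ioi,
      ← integral_indicator measurableSet_Ici]
    congr 1
    ext y
    have hs := Real.sqrt_pos.mpr ht
    by_cases hy : 0 < y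
    · by_cases hy2 : t ≤ y ^ 2
      · have := (hset y hy).mp hy2
        simp [Set.indicator, hy, hy2, Set.mem_Ici.mp this]
      · have := mt (hset y hy).mpr hy2
        simp [Set.indicator, hy2, Set.mem_Ici.not.mp this]
    · have : ¬ Real.sqrt t ≤ y := by linarith
      simp [Set.indicator, hy, this]
  -- The Gaussian tail is integrated exactly; the factor `2π` from polar coordinates then cancels `1
  -- / (2π)`.
  have hval : ∫ y in Set.Ioi (Real.sqrt t), y * (1 / Real.pi * Real.exp (-y ^ 2)) =
      0 - -(1 / (2 * Real.pi) * Real.exp (-Real.sqrt t ^ 2)) := by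
    refine integral_Ioi_of_hasDerivAt_of_nonneg'
      (g := fun y => -(1 / (2 * Real.pi) * Real.exp (-y ^ 2))) (fun y _ => ?_) (fun y hy => ?_) ?_
    · have h1 : HasDerivAt (fun y : ℝ => -y ^ 2) (-(2 * y)) y := by
        simpa using (hasDerivAt_pow 2 y).fun_neg
      refine ((h1.exp.const_mul (1 / (2 * Real.pi))).fun_neg).congr_deriv ?_
      field_simp
    · have : 0 < y := (Real.sqrt_nonneg t).trans_lt hy
      positivity
    · have h2 : Tendsto (fun y : ℝ => Real.exp (-y ^ 2)) atTop (𝓝 0) :=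
        Real.tendsto_exp_neg_atTop_nhds_zero.comp (tendsto_pow_atTop two_ne_zero)
      simpa using (h2.const_mul (1 / (2 * Real.pi))).neg
  rw [hrad, hval, Real.sq_sqrt ht.le, nsmul_eq_mul, smul_eq_mul]
  have := Real.pi_ne_zero
  field_simp
  simp

/-- Half of the Gaussian exponent absorbs the square, by `s ≤ e^s` with `s = ‖z‖² / 2`. -/
theorem integrable_norm_sq_stdGaussian : Integrable (fun z : ℂ => ‖z‖ ^ 2) stdGaussian := by
  rw [stdGaussian, integrable_withDensity_iff (by fun_prop)
    (Eventually.of_forall fun _ => ENNReal.ofReal_lt_top)]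
  have h1 : ∫ z : ℂ, Real.exp (-(1 / 2) * ‖z‖ ^ 2) ≠ 0 := by
    rw [GaussianFourier.integral_rexp_neg_mul_sq_norm (by norm_num)]
    positivity
  refine ((Integrable.of_integral_ne_zero h1).const_mul (2 / Real.pi)).mono' (by fun_prop)
    (Eventually.of_forall fun z => ?_)
  rw [ENNReal.toReal_ofReal (by positivity), Real.norm_eq_abs, abs_of_nonneg (by positivity)]
  have h2 : ‖z‖ ^ 2 / 2 ≤ Real.exp (‖z‖ ^ 2 / 2) := by
    linarith [Real.add_one_le_exp (‖z‖ ^ 2 / 2)]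
  have h3 : Real.exp (-(1 / 2) * ‖z‖ ^ 2) = Real.exp (‖z‖ ^ 2 / 2) * Real.exp (-‖z‖ ^ 2) := by
    rw [← Real.exp_add]
    ring_nf
  rw [h3]
  calc ‖z‖ ^ 2 * (1 / Real.pi * Real.exp (-‖z‖ ^ 2))
      = 2 / Real.pi * (‖z‖ ^ 2 / 2 * Real.exp (-‖z‖ ^ 2)) := by ring
    _ ≤ _ := by gcongr

/-- The Gaussian coordinates of the free field. -/
abbrev gaussianLaw : Measure (ℤ → ℂ) := Measure.infinitePi fun _ : ℤ => stdGaussian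

/-- The occupation number `⌊τ |z|² / λ⌋`, geometrically distributed for a Gaussian `z`. -/
def occupation (τ l : ℝ) (z : ℂ) : ℕ := ⌊τ * (‖z‖ ^ 2 / l)⌋₊

theorem measurable_occupation (τ l : ℝ) : Measurable (occupation τ l) :=
  Nat.measurable_floor.comp (by fun_prop)

/-- The event is a difference of two exponential tails, `e^{-nl/τ} - e^{-(n+1)l/τ}`, which is
`e^{-nl/τ}` times its value at `n = 0`. -/
theorem stdGaussian_occupation {τ l : ℝ} (hτ : 0 < τ) (hl : 0 < l) (n : ℕ) :
    stdGaussian {z | occupation τ l z = n} =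
      stdGaussian {z | occupation τ l z = 0} * ENNReal.ofReal (Real.exp (-(τ⁻¹ * (n * l)))) := by
  have key : ∀ n : ℕ, stdGaussian {z | occupation τ l z = n} =
      ENNReal.ofReal (Real.exp (-(τ⁻¹ * (n * l)))) -
        ENNReal.ofReal (Real.exp (-(τ⁻¹ * ((n + 1) * l)))) := by
    intro n
    have hle : ∀ (s : ℝ) (z : ℂ), s ≤ τ * (‖z‖ ^ 2 / l) ↔ τ⁻¹ * (s * l) ≤ ‖z‖ ^ 2 := by
      intro s z
      rw [inv_mul_le_iff₀ hτ, ← mul_div_assoc, le_div_iff₀ hl]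
    have hset : {z : ℂ | occupation τ l z = n} =
        {z | τ⁻¹ * (n * l) ≤ ‖z‖ ^ 2} \ {z | τ⁻¹ * ((n + 1) * l) ≤ ‖z‖ ^ 2} := by
      ext z
      simp only [Set.mem_ofPred_eq, Set.mem_sdiff, ← hle, not_le, occupation]
      exact Nat.floor_eq_iff (by positivity)
    rw [hset, measure_sdiff, stdGaussian_le_norm_sq (by positivity),
      stdGaussian_le_norm_sq (by positivity)]
    · intro z hz
      simp only [Set.mem_ofPred_eq] at hz ⊢
      refine le_trans ?_ hz
      gcongr
      linarith
    · exact (measurableSet_le measurable_const (by fun_prop)).nullMeasurableSet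
    · exact measure_ne_top _ _
  rw [key, key, ← ENNReal.ofReal_sub _ (Real.exp_pos _).le, ← ENNReal.ofReal_sub _ (Real.exp_pos _).le,
    ← ENNReal.ofReal_mul]
  · congr 1
    rw [sub_mul, ← Real.exp_add, ← Real.exp_add]
    push_cast
    ring_nf
  · rw [sub_nonneg, Real.exp_le_exp]
    push_cast
    have : 0 < τ⁻¹ * l := by positivity
    nlinarith

variable {S : Set ℤ}

/-- The event that the occupation numbers of the modes in `S` are given by `m`. -/
def occupationEvent (τ : ℝ) (m : Multiset S) : Set (ℤ → ℂ) :=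
  open Classical in {g | ∀ k : S, occupation τ (eigenvalue k) (g k) = m.count k}

theorem measurableSet_occupationEvent (τ : ℝ) (m : Multiset S) :
    MeasurableSet (occupationEvent τ m) := by
  classical
  have h : occupationEvent τ m = ⋂ k : S, (fun g : ℤ → ℂ => occupation τ (eigenvalue k) (g k)) ⁻¹'
      {m.count k} := by
    ext g
    simp only [occupationEvent, Set.mem_ofPred_eq, Set.mem_iInter, Set.mem_preimage,
      Set.mem_singleton_iff]
  rw [h]
  exact MeasurableSet.iInter fun k =>
    ((measurable_occupation _ _).comp (measurable_pi_apply _)) (measurableSet_singleton _)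

theorem pairwise_disjoint_occupationEvent (τ : ℝ) :
    Pairwise (Function.onFun Disjoint fun m : Multiset S => occupationEvent τ m) := by
  classical
  intro m m' hm
  refine Set.disjoint_left.mpr fun g h1 h2 => hm ?_
  ext k
  convert (h1 k).symm.trans (h2 k)

theorem hasProd_gaussianLaw_occupationEvent (τ : ℝ) (m : Multiset S) [DecidableEq S] :
    HasProd (fun k : S => stdGaussian {z | occupation τ (eigenvalue k) z = m.count k})
      (gaussianLaw (occupationEvent τ m)) := by
  -- The product measure lives on all of `ℤ`, so the condition is made vacuous outside `S`.
  let t : ℤ → Set ℂ := fun k => {z | ∀ hk : k ∈ S,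
    occupation τ (eigenvalue k) z = m.count (⟨k, hk⟩ : S)}
  have ht : ∀ k : S, t k = {z | occupation τ (eigenvalue k) z = m.count k} := by
    intro k
    ext z
    exact ⟨fun h => h k.2, fun h _ => h⟩
  have hpi : occupationEvent τ m = Set.pi S t := by
    ext g
    simp only [occupationEvent, Set.mem_ofPred_eq, Set.mem_pi, t]
    constructor
    · intro h k hk _
      convert h ⟨k, hk⟩
    · intro h k
      convert h k k.2 k.2
  have hmeas : ∀ k ∈ S, MeasurableSet (t k) := by
    intro k hk
    rw [ht ⟨k, hk⟩]
    exact measurable_occupation _ _ (measurableSet_singleton _)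
  rw [hpi, Measure.infinitePi_pi_of_countable _ S.to_countable hmeas]
  simp only [← ht]
  exact (ENNReal.multipliable_of_le_one fun k : S => prob_le_one (μ := stdGaussian) (s := t k)).hasProd

theorem energy_eq_sum [DecidableEq S] (m : Multiset S) :
    energy m = ∑ k ∈ m.toFinset, m.count k * eigenvalue k := by
  rw [energy, Finset.sum_multiset_map_count]
  simp only [nsmul_eq_mul]

/-- The infinite products for `m` and for the empty multiset differ only in the finitely many modes
occurring in `m`, where the geometric law gives the Boltzmann factors. Partial products over finite
sets containing these modes are compared in the limit. -/
theorem gaussianLaw_occupationEvent {τ : ℝ} (hτ : 0 < τ) (m : Multiset S) :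
    gaussianLaw (occupationEvent τ m) =
      gaussianLaw (occupationEvent τ (0 : Multiset S)) * ENNReal.ofReal (boltzmann τ m) := by
  classical
  have h1 := hasProd_gaussianLaw_occupationEvent τ m
  have h0 := hasProd_gaussianLaw_occupationEvent τ (0 : Multiset S)
  have hR : ENNReal.ofReal (boltzmann τ m) =
      ∏ k ∈ m.toFinset, ENNReal.ofReal (Real.exp (-(τ⁻¹ * (m.count k * eigenvalue k)))) := by
    rw [← ENNReal.ofReal_prod_of_nonneg fun k _ => (Real.exp_pos _).le, ← Real.exp_sum, boltzmann,
      energy_eq_sum, Finset.mul_sum, Finset.sum_neg_distrib]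
  refine tendsto_nhds_unique h1 ?_
  have h2 := ENNReal.Tendsto.mul_const (b := ENNReal.ofReal (boltzmann τ m)) h0
    (Or.inr ENNReal.ofReal_ne_top)
  refine h2.congr' ?_
  filter_upwards [eventually_ge_atTop m.toFinset] with s hs
  rw [hR, Finset.prod_subset (f := fun k : S =>
    ENNReal.ofReal (Real.exp (-(τ⁻¹ * (m.count k * eigenvalue k))))) hs, ← Finset.prod_mul_distrib]
  · refine Finset.prod_congr rfl fun k _ => ?_
    rw [Multiset.count_zero, ← stdGaussian_occupation hτ (eigenvalue_pos k)]
  · intro k _ hk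
    rw [Multiset.count_eq_zero_of_notMem (by simpa using hk)]
    simp

end Occupation

/-! ### Comparison of the quantum and the classical mass -/

section Mass

/-- A summable majorant for the mass of the free field in the mode `k`. -/
def massBound (g : ℤ → ℂ) (k : ℤ) : ℝ := (1 + ‖g k‖ ^ 2) * eigenvalue k ^ (-(2 / 3) : ℝ)

theorem massBound_nonneg (g : ℤ → ℂ) (k : ℤ) : 0 ≤ massBound g k := by
  have := eigenvalue_pos k
  rw [massBound]
  positivity

theorem sq_le_eigenvalue (k : ℤ) : (k : ℝ) ^ 2 ≤ eigenvalue k := by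
  rw [eigenvalue]
  have h1 : (2 : ℝ) ≤ (2 * Real.pi) ^ 2 := by nlinarith [Real.pi_gt_three]
  nlinarith [sq_nonneg (k : ℝ)]

theorem summable_eigenvalue_rpow : Summable fun k : ℤ => eigenvalue k ^ (-(2 / 3) : ℝ) := by
  refine Summable.of_norm_bounded_eventually
    (Real.summable_abs_int_rpow (b := 4 / 3) (by norm_num)) ?_
  -- The mode `k = 0` is set aside: there the comparison power of `|k|` takes the default value `0`.
  filter_upwards [(Set.finite_singleton (0 : ℤ)).compl_mem_cofinite] with k hk
  have hk0 : (k : ℝ) ≠ 0 := by exact_mod_cast hk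
  have hpos := abs_pos.mpr hk0
  rw [Real.norm_eq_abs, abs_of_nonneg (Real.rpow_nonneg (eigenvalue_pos k).le _)]
  have h1 : |(k : ℝ)| ^ (-(4 / 3) : ℝ) = ((k : ℝ) ^ 2) ^ (-(2 / 3) : ℝ) := by
    rw [← sq_abs, ← Real.rpow_natCast, ← Real.rpow_mul hpos.le]
    norm_num
  rw [h1]
  exact Real.rpow_le_rpow_of_nonpos (by positivity) (sq_le_eigenvalue k) (by norm_num)

theorem measurable_massBound (k : ℤ) : Measurable fun g => massBound g k :=
  (measurable_const.add ((measurable_pi_apply k).norm.pow_const 2)).mul_const _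

theorem measurable_tsum_massBound :
    Measurable fun g => ∑' k, ENNReal.ofReal (massBound g k) :=
  Measurable.tsum fun k => (measurable_massBound k).ennreal_ofReal

theorem lintegral_massBound_ne_top :
    ∫⁻ g, ∑' k, ENNReal.ofReal (massBound g k) ∂gaussianLaw ≠ ⊤ := by
  rw [lintegral_tsum fun k => (measurable_massBound k).ennreal_ofReal.aemeasurable]
  have hint : Integrable (fun z : ℂ => 1 + ‖z‖ ^ 2) stdGaussian :=
    (integrable_const 1).add integrable_norm_sq_stdGaussian
  have hk : ∀ k : ℤ, ∫⁻ g, ENNReal.ofReal (massBound g k) ∂gaussianLaw =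
      ENNReal.ofReal ((∫ z, 1 + ‖z‖ ^ 2 ∂stdGaussian) * eigenvalue k ^ (-(2 / 3) : ℝ)) := by
    intro k
    have h1 := (measurePreserving_eval_infinitePi (fun _ : ℤ => stdGaussian) k).lintegral_comp
      (f := fun z : ℂ => ENNReal.ofReal ((1 + ‖z‖ ^ 2) * eigenvalue k ^ (-(2 / 3) : ℝ)))
      (by fun_prop)
    refine h1.trans ?_
    rw [← ofReal_integral_eq_lintegral_ofReal (hint.mul_const _), integral_mul_const]
    refine Eventually.of_forall fun z => ?_
    have := eigenvalue_pos k
    positivity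
  simp only [hk]
  refine (summable_eigenvalue_rpow.mul_left _).tsum_ofReal_ne_top

theorem ae_summable_massBound : ∀ᵐ g ∂gaussianLaw, Summable (massBound g) := by
  filter_upwards [ae_lt_top measurable_tsum_massBound lintegral_massBound_ne_top] with g hg
  refine (ENNReal.summable_toReal hg.ne).congr fun k => ?_
  rw [ENNReal.toReal_ofReal (massBound_nonneg g k)]

theorem integrable_tsum_massBound : Integrable (fun g => ∑' k, massBound g k) gaussianLaw := by
  have h := integrable_toReal_of_lintegral_ne_top measurable_tsum_massBound.aemeasurable
    lintegral_massBound_ne_top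
  refine h.congr (Eventually.of_forall fun g => ?_)
  simp only [ENNReal.tsum_toReal_eq fun k => ENNReal.ofReal_ne_top,
    ENNReal.toReal_ofReal (massBound_nonneg g _)]

theorem mass_le_massBound (g : ℤ → ℂ) (k : ℤ) :
    ‖g k‖ ^ 2 / eigenvalue k ≤ 2 * massBound g k := by
  have hl := eigenvalue_pos k
  have hhalf : 1 / 2 ≤ eigenvalue k := by
    rw [eigenvalue]
    nlinarith [sq_nonneg (2 * Real.pi * k)]
  have h1 : eigenvalue k ^ (-(1 / 3) : ℝ) ≤ 2 := by
    calc eigenvalue k ^ (-(1 / 3) : ℝ) ≤ (1 / 2 : ℝ) ^ (-(1 / 3) : ℝ) :=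
          Real.rpow_le_rpow_of_nonpos (by norm_num) hhalf (by norm_num)
      _ ≤ (1 / 2 : ℝ) ^ (-1 : ℝ) :=
          Real.rpow_le_rpow_of_exponent_ge (by norm_num) (by norm_num) (by norm_num)
      _ = 2 := by rw [Real.rpow_neg_one]; norm_num
  have h2 : (eigenvalue k)⁻¹ = eigenvalue k ^ (-(1 / 3) : ℝ) * eigenvalue k ^ (-(2 / 3) : ℝ) := by
    rw [← Real.rpow_add hl, ← Real.rpow_neg_one]
    norm_num
  rw [div_eq_mul_inv, h2, massBound]
  have h3 := Real.rpow_nonneg hl.le (-(2 / 3) : ℝ)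
  calc ‖g k‖ ^ 2 * (eigenvalue k ^ (-(1 / 3) : ℝ) * eigenvalue k ^ (-(2 / 3) : ℝ))
      ≤ (1 + ‖g k‖ ^ 2) * (2 * eigenvalue k ^ (-(2 / 3) : ℝ)) := by
        gcongr
        linarith
    _ = _ := by ring

theorem occupation_le_mass {τ : ℝ} (hτ : 0 < τ) (g : ℤ → ℂ) (k : ℤ) :
    τ⁻¹ * occupation τ (eigenvalue k) (g k) ≤ ‖g k‖ ^ 2 / eigenvalue k := by
  have := eigenvalue_pos k
  rw [inv_mul_le_iff₀ hτ]
  exact Nat.floor_le (by positivity)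

/-- Rounding down loses `d` with `0 ≤ d ≤ 1/τ` and `d ≤ |g_k|²/λ_k`. Splitting `d = d^{1/3} d^{2/3}`
and using one bound for each factor gives decay in `τ` and summability in `k`. The power of `λ_k`
must exceed `1/2` for summability, and what is left for `τ` must exceed `1/4 + 1/32`; `2/3` and
`1/3` satisfy both. -/
theorem mass_sub_occupation_le {τ : ℝ} (hτ : 0 < τ) (g : ℤ → ℂ) (k : ℤ) :
    ‖g k‖ ^ 2 / eigenvalue k - τ⁻¹ * occupation τ (eigenvalue k) (g k) ≤
      τ ^ (-(1 / 3) : ℝ) * massBound g k := by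
  have hl := eigenvalue_pos k
  set x := ‖g k‖ ^ 2 / eigenvalue k with hx
  set y := τ⁻¹ * (occupation τ (eigenvalue k) (g k) : ℝ) with hy
  have hx0 : 0 ≤ x := by positivity
  have hy0 : 0 ≤ y := by positivity
  have hd0 : 0 ≤ x - y := sub_nonneg.mpr (occupation_le_mass hτ g k)
  have hd1 : x - y ≤ τ⁻¹ := by
    have h1 : τ * x < occupation τ (eigenvalue k) (g k) + 1 := Nat.lt_floor_add_one _
    have h2 : x < τ⁻¹ * (occupation τ (eigenvalue k) (g k) + 1) := by
      rwa [lt_inv_mul_iff₀ hτ]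
    rw [mul_add, ← hy, mul_one] at h2
    linarith
  have h1 : x - y = (x - y) ^ (1 / 3 : ℝ) * (x - y) ^ (2 / 3 : ℝ) := by
    rw [← Real.rpow_add_of_nonneg hd0 (by norm_num) (by norm_num)]
    norm_num
  have h2 : (x - y) ^ (1 / 3 : ℝ) ≤ τ ^ (-(1 / 3) : ℝ) := by
    rw [Real.rpow_neg hτ.le, ← Real.inv_rpow hτ.le]
    exact Real.rpow_le_rpow hd0 hd1 (by norm_num)
  have h3 : (x - y) ^ (2 / 3 : ℝ) ≤ massBound g k := by
    calc (x - y) ^ (2 / 3 : ℝ) ≤ x ^ (2 / 3 : ℝ) :=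
          Real.rpow_le_rpow hd0 (by linarith) (by norm_num)
      _ = (‖g k‖ ^ 2) ^ (2 / 3 : ℝ) * eigenvalue k ^ (-(2 / 3) : ℝ) := by
          rw [hx, Real.div_rpow (by positivity) hl.le, Real.rpow_neg hl.le, div_eq_mul_inv]
      _ ≤ massBound g k := by
          rw [massBound]
          have h4 := Real.rpow_nonneg hl.le (-(2 / 3) : ℝ)
          gcongr
          calc (‖g k‖ ^ 2) ^ (2 / 3 : ℝ) ≤ (1 + ‖g k‖ ^ 2) ^ (2 / 3 : ℝ) :=
                Real.rpow_le_rpow (by positivity) (by linarith) (by norm_num)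
            _ ≤ (1 + ‖g k‖ ^ 2) ^ (1 : ℝ) :=
                Real.rpow_le_rpow_of_exponent_le (by linarith [sq_nonneg ‖g k‖]) (by norm_num)
            _ = 1 + ‖g k‖ ^ 2 := Real.rpow_one _
  rw [h1]
  gcongr

/-- The mass of the classical free field in the modes in `S`. -/
def classicalMass (S : Set ℤ) (g : ℤ → ℂ) : ℝ := ∑' k : S, ‖g k‖ ^ 2 / eigenvalue k

/-- The rescaled number of quantum particles in the modes in `S`. -/
def quantumMass (S : Set ℤ) (τ : ℝ) (g : ℤ → ℂ) : ℝ :=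
  ∑' k : S, τ⁻¹ * occupation τ (eigenvalue k) (g k)

variable {S : Set ℤ}

theorem classicalMass_nonneg (g : ℤ → ℂ) : 0 ≤ classicalMass S g :=
  tsum_nonneg fun k => by
    have := eigenvalue_pos k
    positivity

theorem quantumMass_nonneg {τ : ℝ} (hτ : 0 < τ) (g : ℤ → ℂ) : 0 ≤ quantumMass S τ g :=
  tsum_nonneg fun k => by positivity

theorem summable_mass {g : ℤ → ℂ} (hg : Summable (massBound g)) :
    Summable fun k => ‖g k‖ ^ 2 / eigenvalue k :=
  Summable.of_nonneg_of_le (fun k => by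
    have := eigenvalue_pos k
    positivity) (mass_le_massBound g) (hg.mul_left 2)

theorem summable_occupation {τ : ℝ} (hτ : 0 < τ) {g : ℤ → ℂ} (hg : Summable (massBound g)) :
    Summable fun k => τ⁻¹ * (occupation τ (eigenvalue k) (g k) : ℝ) :=
  Summable.of_nonneg_of_le (fun k => by positivity) (occupation_le_mass hτ g) (summable_mass hg)

theorem abs_quantumMass_sub_classicalMass_le {τ : ℝ} (hτ : 0 < τ) {g : ℤ → ℂ}
    (hg : Summable (massBound g)) :
    |quantumMass S τ g - classicalMass S g| ≤ τ ^ (-(1 / 3) : ℝ) * ∑' k, massBound g k := by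
  have hx := (summable_mass hg).subtype S
  have hy := (summable_occupation hτ hg).subtype S
  have hb := (hg.mul_left (τ ^ (-(1 / 3) : ℝ)))
  rw [abs_sub_comm, classicalMass, quantumMass]
  have h1 : (∑' k : S, ‖g k‖ ^ 2 / eigenvalue k) -
      ∑' k : S, τ⁻¹ * (occupation τ (eigenvalue k) (g k) : ℝ) =
      ∑' k : S, (‖g k‖ ^ 2 / eigenvalue k - τ⁻¹ * (occupation τ (eigenvalue k) (g k) : ℝ)) :=
    (hx.tsum_sub hy).symm
  rw [h1, abs_of_nonneg (tsum_nonneg fun k : S => sub_nonneg.mpr (occupation_le_mass hτ g k)),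
    ← tsum_mul_left]
  have hxy : Summable fun k : S =>
      ‖g k‖ ^ 2 / eigenvalue k - τ⁻¹ * (occupation τ (eigenvalue k) (g k) : ℝ) := hx.sub hy
  have hbS : Summable fun k : S => τ ^ (-(1 / 3) : ℝ) * massBound g k := hb.subtype S
  refine (Summable.tsum_le_tsum (fun k : S => mass_sub_occupation_le hτ g k) hxy hbS).trans ?_
  exact hb.tsum_subtype_le _ S fun k =>
    mul_nonneg (Real.rpow_nonneg hτ.le _) (massBound_nonneg g k)

theorem measurable_quantumMass (τ : ℝ) : Measurable (quantumMass S τ) := by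
  refine Measurable.tsum fun k => ?_
  have h : Measurable fun g : ℤ → ℂ => (occupation τ (eigenvalue k) (g k) : ℝ) :=
    measurable_from_nat.comp ((measurable_occupation _ _).comp (measurable_pi_apply (k : ℤ)))
  exact h.const_mul _

theorem measurable_classicalMass : Measurable (classicalMass S) :=
  Measurable.tsum fun k => ((measurable_pi_apply (k : ℤ)).norm.pow_const 2).div_const _

theorem integrable_comp_of_nonneg {Ω : Type*} [MeasurableSpace Ω] {μ : Measure Ω}
    [IsFiniteMeasure μ] {f : ℝ → ℝ} {C : ℝ} (hf : ContinuousOn f (Set.Ici 0))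
    (hC : ∀ s, 0 ≤ s → |f s| ≤ C) {X : Ω → ℝ} (hX : Measurable X) (h0 : ∀ x, 0 ≤ X x) :
    Integrable (fun x => f (X x)) μ := by
  -- Only the values of `f` on the half-line are controlled, so `f` is extended by its value at `0`.
  have h1 : Continuous fun s => f (max 0 s) :=
    hf.comp_continuous (by fun_prop) fun s => Set.mem_Ici.mpr (le_max_left _ _)
  have h2 : (fun x => f (X x)) = fun x => f (max 0 (X x)) := by
    ext x
    rw [max_eq_right (h0 x)]
  refine Integrable.of_bound ?_ C (Eventually.of_forall fun x => hC _ (h0 x))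
  rw [h2]
  exact (h1.measurable.comp hX).aestronglyMeasurable

theorem quantumMass_of_mem_occupationEvent {τ : ℝ} {m : Multiset S} {g : ℤ → ℂ}
    (hg : g ∈ occupationEvent τ m) : quantumMass S τ g = τ⁻¹ * m.card := by
  classical
  have h : ∀ k : S, occupation τ (eigenvalue k) (g k) = m.count k := fun k => by
    convert hg k
  simp only [quantumMass, h]
  rw [tsum_mul_left, tsum_eq_sum (s := m.toFinset)]
  · rw [← Nat.cast_sum, Multiset.toFinset_sum_count_eq]
  · intro k hk
    rw [Multiset.count_eq_zero_of_notMem (by simpa using hk), Nat.cast_zero]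

/-- A summable family whose nonzero terms are at least `τ⁻¹` has finite support, so the occupation
numbers form a multiset. -/
theorem exists_mem_occupationEvent {τ : ℝ} (hτ : 0 < τ) {g : ℤ → ℂ}
    (hg : Summable (massBound g)) : ∃ m : Multiset S, g ∈ occupationEvent τ m := by
  classical
  have hfin : {k : S | occupation τ (eigenvalue k) (g k) ≠ 0}.Finite := by
    have h1 := ((summable_occupation hτ hg).subtype S).tendsto_cofinite_zero
    have h2 := h1.eventually (gt_mem_nhds (inv_pos.mpr hτ))
    refine (eventually_cofinite.mp h2).subset fun (k : S) hk => ?_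
    have h3 : (1 : ℝ) ≤ occupation τ (eigenvalue (k : ℤ)) (g (k : ℤ)) := by
      exact_mod_cast Nat.one_le_iff_ne_zero.mpr hk
    have h4 : 0 < τ⁻¹ := inv_pos.mpr hτ
    simp only [Set.mem_ofPred_eq, not_lt, Function.comp]
    nlinarith
  refine ⟨Finsupp.toMultiset (Finsupp.ofSupportFinite
    (fun k : S => occupation τ (eigenvalue k) (g k)) hfin), fun k => ?_⟩
  have h5 := Finsupp.count_toMultiset (Finsupp.ofSupportFinite
    (fun k : S => occupation τ (eigenvalue k) (g k)) hfin) k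
  convert h5.symm
  rfl

/-- Up to a null set the occupation events partition the space. The quantum mass is constant on
each, and their probabilities are the normalised Boltzmann weights. -/
theorem hasSum_integral_quantumMass {τ : ℝ} (hτ : 0 < τ) {f : ℝ → ℝ} {C : ℝ}
    (hf : ContinuousOn f (Set.Ici 0)) (hC : ∀ s, 0 ≤ s → |f s| ≤ C) :
    HasSum (fun m : Multiset S => gaussianLaw.real (occupationEvent τ (0 : Multiset S)) *
      boltzmann τ m * f (τ⁻¹ * m.card)) (∫ g, f (quantumMass S τ g) ∂gaussianLaw) := by
  have hint := integrable_comp_of_nonneg (μ := gaussianLaw) hf hC (measurable_quantumMass (S := S) τ)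
    (quantumMass_nonneg hτ)
  have h := hasSum_integral_iUnion (fun m : Multiset S => measurableSet_occupationEvent τ m)
    (pairwise_disjoint_occupationEvent τ) hint.integrableOn
  have huniv : (⋃ m : Multiset S, occupationEvent τ m) =ᵐ[gaussianLaw] Set.univ := by
    refine ae_eq_univ.mpr (mem_ae_iff.mp ?_)
    filter_upwards [ae_summable_massBound] with g hg
    exact Set.mem_iUnion.mpr (exists_mem_occupationEvent hτ hg)
  rw [setIntegral_congr_set huniv, setIntegral_univ] at h
  refine h.congr_fun fun m => ?_
  rw [setIntegral_congr_fun (measurableSet_occupationEvent τ m)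
    (g := fun _ => f (τ⁻¹ * m.card)) fun g hg => by
      simp only [quantumMass_of_mem_occupationEvent hg], setIntegral_const, smul_eq_mul]
  congr 1
  rw [Measure.real, Measure.real, gaussianLaw_occupationEvent hτ m, ENNReal.toReal_mul,
    ENNReal.toReal_ofReal (boltzmann_nonneg τ m)]

/-- The case `f = 1`: the weights are probabilities of a partition. Finiteness of the partition
function comes from here. -/
theorem hasSum_boltzmann {τ : ℝ} (hτ : 0 < τ) :
    HasSum (fun m : Multiset S => gaussianLaw.real (occupationEvent τ (0 : Multiset S)) *
      boltzmann τ m) 1 := by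
  simpa using hasSum_integral_quantumMass (S := S) hτ (f := fun _ => 1) (C := 1)
    continuousOn_const (by simp)

theorem abs_integral_quantumMass_sub_le {τ : ℝ} (hτ : 0 < τ) {f : ℝ → ℝ} {C L : ℝ} (hL0 : 0 ≤ L)
    (hf : ContinuousOn f (Set.Ici 0)) (hC : ∀ s, 0 ≤ s → |f s| ≤ C)
    (hL : ∀ s t, 0 ≤ s → 0 ≤ t → |f s - f t| ≤ L * |s - t|) :
    |∫ g, f (quantumMass S τ g) ∂gaussianLaw - ∫ g, f (classicalMass S g) ∂gaussianLaw| ≤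
      L * τ ^ (-(1 / 3) : ℝ) * ∫ g, ∑' k, massBound g k ∂gaussianLaw := by
  rw [← integral_sub
    (integrable_comp_of_nonneg hf hC (measurable_quantumMass τ) (quantumMass_nonneg hτ))
    (integrable_comp_of_nonneg hf hC measurable_classicalMass classicalMass_nonneg),
    ← integral_const_mul, ← Real.norm_eq_abs]
  refine norm_integral_le_of_norm_le (integrable_tsum_massBound.const_mul _) ?_
  filter_upwards [ae_summable_massBound] with g hg
  rw [Real.norm_eq_abs, mul_assoc]
  refine (hL _ _ (quantumMass_nonneg hτ g) (classicalMass_nonneg g)).trans ?_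
  gcongr
  exact abs_quantumMass_sub_classicalMass_le hτ hg

end Mass

/-! ### Norms of the free field and the resulting trace estimate -/

section FreeField

theorem measurable_freeField : Measurable freeField := by
  have : Fact ((2 : ℝ≥0∞) ≠ ⊤) := ⟨ENNReal.ofNat_ne_top⟩
  refine Measurable.tsum fun k => ?_
  have h : Continuous fun z : ℂ => (z / (Real.sqrt (eigenvalue k) : ℂ)) • mode k := by fun_prop
  exact h.measurable.comp (measurable_pi_apply k)

theorem norm_sq_coefficient (g : ℤ → ℂ) (k : ℤ) :
    ‖g k / (Real.sqrt (eigenvalue k) : ℂ)‖ ^ 2 = ‖g k‖ ^ 2 / eigenvalue k := by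
  rw [norm_div, div_pow, Complex.norm_real, Real.norm_eq_abs, sq_abs,
    Real.sq_sqrt (eigenvalue_pos k).le]

/-- When `massBound g` is summable, the coefficients are square summable, so the series defining
`freeField g` converges and its sum is not the default value. -/
theorem inner_freeField {g : ℤ → ℂ} (hg : Summable (massBound g)) (k : ℤ) :
    ⟪mode k, freeField g⟫_ℂ = g k / (Real.sqrt (eigenvalue k) : ℂ) := by
  have ho : Orthonormal ℂ mode := orthonormal_fourier
  have hs : Summable fun k : ℤ => (g k / (Real.sqrt (eigenvalue k) : ℂ)) • mode k := by
    refine (ho.orthogonalFamily.summable_iff_norm_sq_summable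
      fun k => g k / (Real.sqrt (eigenvalue k) : ℂ)).mpr ?_
    simpa only [norm_sq_coefficient] using summable_mass hg
  have h := (hs.hasSum.mapL (innerSL ℂ (mode k))).tsum_eq
  refine h.symm.trans ?_
  simp only [innerSL_apply_apply, inner_smul_right, inner_mode_mode, mul_ite, mul_one, mul_zero]
  rw [tsum_eq_single k fun j hj => if_neg hj.symm, if_pos rfl]

theorem norm_sq_proj_freeField {S : Set ℤ} {B : OneParticle →L[ℂ] OneParticle}
    (hB : ∀ u k, ⟪mode k, B u⟫_ℂ = S.indicator (fun k => ⟪mode k, u⟫_ℂ) k) {g : ℤ → ℂ}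
    (hg : Summable (massBound g)) : ‖B (freeField g)‖ ^ 2 = classicalMass S g := by
  have h := hasSum_norm_inner_sq (fourierBasis : HilbertBasis ℤ ℂ OneParticle) (B (freeField g))
  rw [coe_fourierBasis] at h
  rw [← h.tsum_eq, classicalMass, tsum_subtype S fun k => ‖g k‖ ^ 2 / eigenvalue k]
  refine tsum_congr fun k => ?_
  rw [hB]
  by_cases hk : k ∈ S
  · rw [Set.indicator_of_mem hk, Set.indicator_of_mem hk, inner_freeField hg, norm_sq_coefficient]
  · rw [Set.indicator_of_notMem hk, Set.indicator_of_notMem hk, norm_zero, zero_pow two_ne_zero]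

theorem integral_freeMeasure {S : Set ℤ} {B : OneParticle →L[ℂ] OneParticle}
    (hB : ∀ u k, ⟪mode k, B u⟫_ℂ = S.indicator (fun k => ⟪mode k, u⟫_ℂ) k) {f : ℝ → ℝ}
    (hf : ContinuousOn f (Set.Ici 0)) :
    ∫ u, f (‖B u‖ ^ 2) ∂freeMeasure = ∫ g, f (classicalMass S g) ∂gaussianLaw := by
  have hc : Continuous fun u : OneParticle => f (‖B u‖ ^ 2) :=
    hf.comp_continuous (by fun_prop) fun u => Set.mem_Ici.mpr (sq_nonneg _)
  rw [freeMeasure, integral_map measurable_freeField.aemeasurable hc.aestronglyMeasurable]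
  refine integral_congr_ae ?_
  filter_upwards [ae_summable_massBound] with g hg
  rw [norm_sq_proj_freeField hB hg]

/-- The absolute constant in the comparison of the quantum and the classical free states. -/
def couplingConstant : ℝ := ∫ g, ∑' k, massBound g k ∂gaussianLaw

theorem couplingConstant_nonneg : 0 ≤ couplingConstant :=
  integral_nonneg fun g => tsum_nonneg (massBound_nonneg g)

theorem IsModeSystem.isTraceClass {S : Set ℤ} {V : Submodule ℂ OneParticle}
    {A : Operator OneParticle} (h : IsModeSystem S V A) {τ : ℝ} (hτ : 0 < τ) :
    IsTraceClass (gibbsWeight V A τ) := by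
  refine h.isTraceClass_gibbsWeight hτ ?_
  have h1 := hasSum_boltzmann (S := S) hτ
  refine (summable_mul_left_iff fun h0 => ?_).mp h1.summable
  simp only [h0, zero_mul] at h1
  exact zero_ne_one (hasSum_zero.unique h1)

/-- The common core of all the convergence claims: `B` is the identity when `S` is all of `ℤ`, and
the spectral projection for the low modes. -/
theorem IsModeSystem.isTraceClass_and_norm_trace_sub_le {S : Set ℤ} {V : Submodule ℂ OneParticle}
    {A : Operator OneParticle} (h : IsModeSystem S V A) {B : OneParticle →L[ℂ] OneParticle}
    (hB : ∀ u k, ⟪mode k, B u⟫_ℂ = S.indicator (fun k => ⟪mode k, u⟫_ℂ) k) {τ : ℝ} (hτ : 0 < τ)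
    {f : ℝ → ℝ} {C L : ℝ} (hf : ContinuousOn f (Set.Ici 0)) (hf0 : ∀ s, 0 ≤ s → 0 ≤ f s)
    (hC : ∀ s, 0 ≤ s → f s ≤ C) (hL0 : 0 ≤ L)
    (hL : ∀ s t, 0 ≤ s → 0 ≤ t → |f s - f t| ≤ L * |s - t|) :
    IsTraceClass (gibbsState V A τ ∘L massCutoff V f τ) ∧
      ‖trace (gibbsState V A τ ∘L massCutoff V f τ) -
        ((∫ u, f (‖B u‖ ^ 2) ∂freeMeasure : ℝ) : ℂ)‖ ≤
          L * τ ^ (-(1 / 3) : ℝ) * couplingConstant := by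
  have habs : ∀ s, 0 ≤ s → |f s| ≤ C := fun s hs => by
    rw [abs_of_nonneg (hf0 s hs)]
    exact hC s hs
  obtain ⟨h1, h2⟩ := h.gibbsState_comp_massCutoff hτ (hasSum_boltzmann hτ) hf0 hC
  refine ⟨h1, ?_⟩
  rw [h2, (hasSum_integral_quantumMass hτ hf habs).tsum_eq, integral_freeMeasure hB hf,
    ← Complex.ofReal_sub, Complex.norm_real, Real.norm_eq_abs]
  exact abs_integral_quantumMass_sub_le hτ hL0 hf habs hL

end FreeField

/-! ### Bounds and Lipschitz constants of the cutoff functions -/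

section Cutoff

theorem abs_sub_le_of_derivWithin_le {f : ℝ → ℝ} {L : ℝ} (hf : ContDiffOn ℝ ∞ f (Set.Ici 0))
    (hL : ∀ s, 0 ≤ s → |derivWithin f (Set.Ici 0) s| ≤ L) (s t : ℝ) (hs : 0 ≤ s) (ht : 0 ≤ t) :
    |f s - f t| ≤ L * |s - t| :=
  Convex.norm_image_sub_le_of_norm_derivWithin_le (hf.differentiableOn (by norm_num)) hL
    (convex_Ici 0) ht hs

theorem IsCutoffFamily.exists_lipschitz {K : ℝ} {f : ℝ → ℝ → ℝ} (hf : IsCutoffFamily K f) :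
    ∃ c : ℝ, 0 < c ∧ ∀ η ∈ Set.Ioo 0 (K ^ 2 / 2), ∀ s t, 0 ≤ s → 0 ≤ t →
      |f η s - f η t| ≤ c * η⁻¹ * |s - t| := by
  obtain ⟨c, hc⟩ := hf.deriv_bound 1 le_rfl
  -- The given derivative bound may not be positive; the maximum with `1` is.
  refine ⟨max c 1, by positivity, fun η hη => abs_sub_le_of_derivWithin_le (hf.contDiffOn η hη)
    fun s hs => ?_⟩
  have h := hc η hη s hs
  rw [iteratedDerivWithin_one, pow_one] at h
  have hη0 : 0 < η⁻¹ := inv_pos.mpr hη.1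
  exact h.trans (by gcongr; exact le_max_left _ _)

theorem IsSmoothCutoff.exists_bound {g : ℝ → ℝ} (hg : IsSmoothCutoff g) :
    ∃ C, ∀ s, 0 ≤ s → g s ≤ C := by
  obtain ⟨R, hR⟩ := hg.compact_support
  obtain ⟨C, hC⟩ := (isCompact_Icc (a := (0 : ℝ)) (b := R)).bddAbove_image
    (hg.contDiffOn.continuousOn.mono Set.Icc_subset_Ici_self)
  refine ⟨max C 0, fun s hs => ?_⟩
  rcases le_or_gt s R with h | h
  · exact (hC ⟨s, ⟨hs, h⟩, rfl⟩).trans (le_max_left _ _)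
  · rw [hR s h]
    exact le_max_right _ _

theorem IsSmoothCutoff.exists_lipschitz {g : ℝ → ℝ} (hg : IsSmoothCutoff g) :
    ∃ L, 0 ≤ L ∧ ∀ s t, 0 ≤ s → 0 ≤ t → |g s - g t| ≤ L * |s - t| := by
  obtain ⟨R, hR⟩ := hg.compact_support
  have hcont : ContinuousOn (derivWithin g (Set.Ici 0)) (Set.Ici 0) :=
    hg.contDiffOn.continuousOn_derivWithin (uniqueDiffOn_Ici 0) (by norm_num)
  obtain ⟨C, hC⟩ := (isCompact_Icc (a := (0 : ℝ)) (b := R)).exists_bound_of_continuousOn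
    (hcont.mono Set.Icc_subset_Ici_self)
  refine ⟨max C 0, le_max_right _ _, abs_sub_le_of_derivWithin_le hg.contDiffOn fun s hs => ?_⟩
  rcases le_or_gt s R with h | h
  · exact (hC s ⟨hs, h⟩).trans (le_max_left _ _)
  -- Beyond the support `g` vanishes on a neighbourhood, hence so does its derivative.
  · have heq : g =ᶠ[𝓝 s] fun _ => 0 := by
      filter_upwards [lt_mem_nhds h] with t ht
      exact hR t ht
    rw [(heq.filter_mono nhdsWithin_le_nhds).derivWithin_eq (hR s h), derivWithin_fun_const]
    simp

end Cutoff

end FreeGibbs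

end

/-! ### The proposition: matching the powers of `τ` -/

theorem propositionA1 (K : ℝ) (hK : 0 < K) (f : ℝ → ℝ → ℝ) (hf : FreeGibbs.IsCutoffFamily K f) :
    -- the free Gibbs states are well defined
    (∀ τ : ℝ, 0 < τ → FreeGibbs.IsTraceClass (FreeGibbs.freeWeight τ)) ∧
    (∀ Λ τ : ℝ, 0 < Λ → 0 < τ → FreeGibbs.IsTraceClass (FreeGibbs.lowWeight Λ τ)) ∧
    -- convergence for the cutoffs `f_η`, as `τ → ∞` and `η → 0` with `τ^{-1/64} ≤ η < K²/2`
    ((∀ τ η : ℝ, 0 < τ → 0 < η → η < K ^ 2 / 2 →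
        FreeGibbs.IsTraceClass
          (FreeGibbs.freeState τ ∘L FreeGibbs.massCutoff ⊤ (f η) τ)) ∧
      Tendsto
        (fun p : ℝ × ℝ =>
          ‖FreeGibbs.trace (FreeGibbs.freeState p.1 ∘L FreeGibbs.massCutoff ⊤ (f p.2) p.1) -
            ((∫ u, f p.2 (‖u‖ ^ 2) ∂FreeGibbs.freeMeasure : ℝ) : ℂ)‖)
        ((atTop ×ˢ 𝓝[>] (0 : ℝ)) ⊓
          𝓟 {p : ℝ × ℝ | p.1 ^ (-(1 / 64) : ℝ) ≤ p.2 ∧ p.2 < K ^ 2 / 2})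
        (𝓝 0)) ∧
    -- convergence for a fixed cutoff
    (∀ g : ℝ → ℝ, FreeGibbs.IsSmoothCutoff g →
      (∀ τ : ℝ, 0 < τ →
        FreeGibbs.IsTraceClass (FreeGibbs.freeState τ ∘L FreeGibbs.massCutoff ⊤ g τ)) ∧
      Tendsto
        (fun τ : ℝ => FreeGibbs.trace (FreeGibbs.freeState τ ∘L FreeGibbs.massCutoff ⊤ g τ))
        atTop (𝓝 ((∫ u, g (‖u‖ ^ 2) ∂FreeGibbs.freeMeasure : ℝ) : ℂ))) ∧
    -- the quantitative projected version
    (∃ C : ℝ, 0 < C ∧ ∃ τ₀ : ℝ, 0 < τ₀ ∧ ∀ τ : ℝ, τ₀ ≤ τ → ∀ η : ℝ, 0 < η → η < K ^ 2 / 2 → ∀ Λ : ℝ, 0 < Λ →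
      η⁻¹ ≤ Λ ^ (1 / 8 : ℝ) → Λ ^ (1 / 8 : ℝ) ≤ τ ^ (1 / 32 : ℝ) →
      FreeGibbs.IsTraceClass
        (FreeGibbs.lowState Λ τ ∘L FreeGibbs.massCutoff (FreeGibbs.lowSpace Λ) (f η) τ) ∧
      ‖FreeGibbs.trace
            (FreeGibbs.lowState Λ τ ∘L
              FreeGibbs.massCutoff (FreeGibbs.lowSpace Λ) (f η) τ) -
          ((∫ u, f η (‖FreeGibbs.lowProj Λ u‖ ^ 2) ∂FreeGibbs.freeMeasure : ℝ) : ℂ)‖ ≤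
        C * τ ^ (-(1 / 4) : ℝ)) := by
  have htop : ∀ u k, ⟪FreeGibbs.mode k, ContinuousLinearMap.id ℂ FreeGibbs.OneParticle u⟫_ℂ =
      (Set.univ : Set ℤ).indicator (fun k => ⟪FreeGibbs.mode k, u⟫_ℂ) k := fun u k => by
    rw [Set.indicator_univ, ContinuousLinearMap.id_apply]
  obtain ⟨c, hc0, hc⟩ := hf.exists_lipschitz
  have hD := FreeGibbs.couplingConstant_nonneg
  set D := FreeGibbs.couplingConstant
  have hfree : ∀ τ η : ℝ, 0 < τ → 0 < η → η < K ^ 2 / 2 → _ := fun τ η hτ h0 h1 =>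
    FreeGibbs.isModeSystem_oneBody.isTraceClass_and_norm_trace_sub_le htop hτ
      (hf.contDiffOn η ⟨h0, h1⟩).continuousOn (fun s hs => (hf.mem_Icc η ⟨h0, h1⟩ s hs).1)
      (fun s hs => (hf.mem_Icc η ⟨h0, h1⟩ s hs).2) (by positivity) (hc η ⟨h0, h1⟩)
  have hlow : ∀ Λ τ η : ℝ, 0 < τ → 0 < η → η < K ^ 2 / 2 → _ := fun Λ τ η hτ h0 h1 =>
    (FreeGibbs.isModeSystem_low Λ).isTraceClass_and_norm_trace_sub_le
      (FreeGibbs.inner_lowProj Λ) hτ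
      (hf.contDiffOn η ⟨h0, h1⟩).continuousOn (fun s hs => (hf.mem_Icc η ⟨h0, h1⟩ s hs).1)
      (fun s hs => (hf.mem_Icc η ⟨h0, h1⟩ s hs).2) (by positivity) (hc η ⟨h0, h1⟩)
  refine ⟨fun τ hτ => FreeGibbs.isModeSystem_oneBody.isTraceClass hτ,
    fun Λ τ _ hτ => (FreeGibbs.isModeSystem_low Λ).isTraceClass hτ,
    ⟨fun τ η hτ h0 h1 => (hfree τ η hτ h0 h1).1, ?_⟩, fun g hg => ?_, ?_⟩
  -- The exponent is `61/192 = 1/3 - 1/64`, the loss `1/64` coming from `η⁻¹ ≤ τ^{1/64}`.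
  · have hlim : Tendsto (fun p : ℝ × ℝ => c * D * p.1 ^ (-(61 / 192) : ℝ))
        ((atTop ×ˢ 𝓝[>] (0 : ℝ)) ⊓
          𝓟 {p : ℝ × ℝ | p.1 ^ (-(1 / 64) : ℝ) ≤ p.2 ∧ p.2 < K ^ 2 / 2}) (𝓝 0) := by
      have h1 : Tendsto (fun τ : ℝ => c * D * τ ^ (-(61 / 192) : ℝ)) atTop (𝓝 0) := by
        simpa using (tendsto_rpow_neg_atTop (y := 61 / 192) (by norm_num)).const_mul (c * D)
      exact h1.comp (tendsto_fst.mono_left inf_le_left)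
    refine squeeze_zero' (Eventually.of_forall fun p => norm_nonneg _) ?_ hlim
    rw [eventually_inf_principal]
    filter_upwards [tendsto_fst.eventually (eventually_gt_atTop (0 : ℝ)),
      tendsto_snd.eventually self_mem_nhdsWithin] with p hp1 hp2 hp
    refine (hfree p.1 p.2 hp1 hp2 hp.2).2.trans ?_
    have hη : p.2⁻¹ ≤ p.1 ^ (1 / 64 : ℝ) := by
      rw [← inv_inv (p.1 ^ (1 / 64 : ℝ)), ← Real.rpow_neg hp1.le]
      exact inv_anti₀ (Real.rpow_pos_of_pos hp1 _) hp.1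
    calc c * p.2⁻¹ * p.1 ^ (-(1 / 3) : ℝ) * D
        ≤ c * p.1 ^ (1 / 64 : ℝ) * p.1 ^ (-(1 / 3) : ℝ) * D := by gcongr
      _ = c * D * (p.1 ^ (1 / 64 : ℝ) * p.1 ^ (-(1 / 3) : ℝ)) := by ring
      _ = c * D * p.1 ^ (-(61 / 192) : ℝ) := by
          rw [← Real.rpow_add hp1]
          norm_num
  · obtain ⟨C, hC⟩ := hg.exists_bound
    obtain ⟨L, hL0, hL⟩ := hg.exists_lipschitz
    have hgt : ∀ τ : ℝ, 0 < τ → _ := fun τ hτ =>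
      FreeGibbs.isModeSystem_oneBody.isTraceClass_and_norm_trace_sub_le htop hτ
        hg.contDiffOn.continuousOn hg.nonneg hC hL0 hL
    refine ⟨fun τ hτ => (hgt τ hτ).1, ?_⟩
    rw [tendsto_iff_norm_sub_tendsto_zero]
    have hlim : Tendsto (fun τ : ℝ => L * τ ^ (-(1 / 3) : ℝ) * D) atTop (𝓝 0) := by
      simpa using
        ((tendsto_rpow_neg_atTop (y := 1 / 3) (by norm_num)).const_mul L).mul_const D
    refine squeeze_zero' (Eventually.of_forall fun τ => norm_nonneg _) ?_ hlim
    filter_upwards [eventually_gt_atTop (0 : ℝ)] with τ hτ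
    exact (hgt τ hτ).2
  -- Here `η⁻¹ ≤ τ^{1/32}` leaves the exponent `1/3 - 1/32 = 29/96 ≥ 1/4`. Comparing the two powers
  -- needs `τ ≥ 1`, whence the threshold; the added `1` makes the constant positive even if `D = 0`.
  · refine ⟨c * D + 1, by positivity, 1, one_pos, fun τ hτ η h0 h1 Λ _ hη hΛ => ?_⟩
    have hτ0 : 0 < τ := one_pos.trans_le hτ
    refine ⟨(hlow Λ τ η hτ0 h0 h1).1, (hlow Λ τ η hτ0 h0 h1).2.trans ?_⟩
    have hη' := hη.trans hΛ
    calc c * η⁻¹ * τ ^ (-(1 / 3) : ℝ) * D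
        ≤ c * τ ^ (1 / 32 : ℝ) * τ ^ (-(1 / 3) : ℝ) * D := by gcongr
      _ = c * D * (τ ^ (1 / 32 : ℝ) * τ ^ (-(1 / 3) : ℝ)) := by ring
      _ = c * D * τ ^ (-(29 / 96) : ℝ) := by
          rw [← Real.rpow_add hτ0]
          norm_num
      _ ≤ c * D * τ ^ (-(1 / 4) : ℝ) := by
          gcongr ?_ * ?_
          exact Real.rpow_le_rpow_of_exponent_le hτ (by norm_num)
      _ ≤ (c * D + 1) * τ ^ (-(1 / 4) : ℝ) := by
          gcongr
          linarith
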